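/- Let $\Theta\subset\mathbb R^2$ be the unit disk with Lebesgue measure. Let $0<z_1<z_2<\cdots$ be the positive zeros of the Bessel function $J_0$, and let $e_n(x)=J_0(z_n|x|)/\|J_0(z_n|\cdot|)\|_{L^2(\Theta)}$ be the normalized radial Dirichlet eigenfunctions of $-\Delta$ on $\Theta$, with eigenvalues $z_n^2$. For a radial function $u=\sum_n c_ne_n\in L^2(\Theta)$ with $c_n\in\mathbb C$, put $$S_\alpha(t)u=\sum_{n} e^{-itz_n^{2\alpha}}c_ne_n,\qquad \mathbf 1_{\sqrt{-\Delta}\in[N,2N]}u=\sum_{n:\,z_n\in[N,2N]}c_ne_n .$$ **Lemma (bilinear Strichartz estimates).** Let $\alpha\in[\tfrac12,1)$ and $\varepsilon>0$. There is a constant $C>0$, depending only on $\alpha$ and $\varepsilon$, such that for all real $N_1,N_2>0$ and all radial $u_1,u_2\in L^2(\Theta)$ with $\mathbf 1_{\sqrt{-\Delta}\in[N_j,2N_j]}u_j=u_j$ $(j=1,2)$ the following hold. 1. If $N_1\ge N_2$, then $$\|S_\alpha(t)u_1\,S_\alpha(t)u_2\|_{L^2_{t,x}((0,1)\times\Theta)}\le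 C\,N_2^{\frac12+\varepsilon}\,\|u_1\|_{L^2(\Theta)}\|u_2\|_{L^2(\Theta)} .$$ 2. For every $t\in\mathbb R$ the function $S_\alpha(t)u_1$ has a weak gradient on $\Theta$, and $$\|\nabla S_\alpha(t)u_1\,S_\alpha(t)u_2\|_{L^2_{t,x}((0,1)\times\Theta)}\le C\,N_1N_2^{\frac12+\varepsilon}\,\|u_1\|_{L^2(\Theta)}\|u_2\|_{L^2(\Theta)} .$$ -/

import Mathlib

open MeasureTheory Set
open scoped ENNReal ContDiff

noncomputable section

namespace RadialDisk

/-- The Euclidean plane. -/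
abbrev Plane : Type := EuclideanSpace ℝ (Fin 2)

/-- The unit disk `Θ` of the plane. -/
def disk : Set Plane := Metric.ball 0 1

/-- Lebesgue measure on `Θ`. -/
def diskMeasure : Measure Plane := volume.restrict disk

instance : IsFiniteMeasure diskMeasure :=
  ⟨by
    rw [diskMeasure, Measure.restrict_apply_univ]
    exact measure_ball_lt_top⟩

/-- The complex Hilbert space `L²(Θ)`. -/
abbrev L2 : Type := Lp ℂ 2 diskMeasure

/-- The Bessel function of order zero,
`J₀(x) = (1/π) ∫₀^π cos (x sin θ) dθ`. -/
def besselJ0 (x : ℝ) : ℝ :=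
  Real.pi⁻¹ * ∫ θ in (0 : ℝ)..Real.pi, Real.cos (x * Real.sin θ)

theorem continuous_besselJ0 : Continuous besselJ0 := by
  unfold besselJ0
  refine continuous_const.mul ?_
  exact intervalIntegral.continuous_parametric_intervalIntegral_of_continuous'
    (f := fun x θ => Real.cos (x * Real.sin θ)) (by fun_prop) 0 Real.pi

/-- The set `{z₁ < z₂ < ⋯}` of the positive zeros of `J₀`, that is, the spectrum of `√(-Δ)` on
radial functions on `Θ` with the Dirichlet boundary condition. Families indexed by `n = 1, 2, …`
through `zₙ` are indexed here by the elements of this set. -/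
def besselZeros : Set ℝ := {z | 0 < z ∧ besselJ0 z = 0}

/-- The function `x ↦ J₀(z |x|)`. -/
def besselMode (z : ℝ) (x : Plane) : ℂ := (besselJ0 (z * ‖x‖) : ℂ)

theorem memLp_besselMode (z : ℝ) : MemLp (besselMode z) 2 diskMeasure := by
  have hc : Continuous (besselMode z) := by
    unfold besselMode
    exact Complex.continuous_ofReal.comp
      (continuous_besselJ0.comp (continuous_const.mul continuous_norm))
  obtain ⟨C, hC⟩ := (isCompact_closedBall (0 : Plane) 1).exists_bound_of_continuousOn
    hc.continuousOn
  refine MemLp.of_bound hc.aestronglyMeasurable C ?_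
  unfold diskMeasure disk
  filter_upwards [ae_restrict_mem measurableSet_ball] with x hx
  exact hC x (Metric.ball_subset_closedBall hx)

/-- The function `x ↦ J₀(z |x|)` as an element of `L²(Θ)`. -/
def besselModeL2 (z : ℝ) : L2 := (memLp_besselMode z).toLp (besselMode z)

/-- The normalized radial Dirichlet eigenfunction `J₀(z |x|) / ‖J₀(z |·|)‖_{L²(Θ)}`
with eigenvalue `z²`, where `z` is a positive zero of `J₀`. -/
def eigenfun (z : ℝ) : L2 := ((‖besselModeL2 z‖⁻¹ : ℝ) : ℂ) • besselModeL2 z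

/-- The operator `m(√(-Δ))` on radial functions, `∑ₙ cₙ eₙ ↦ ∑ₙ m(zₙ) cₙ eₙ` with
`cₙ = ⟨eₙ, u⟩`; the series converges in `L²(Θ)` for every bounded `m`. -/
def spectralMultiplier (m : ℝ → ℂ) (u : L2) : L2 :=
  ∑' z : besselZeros, (m z * inner ℂ (eigenfun z) u) • eigenfun z

/-- The spectral projection `1_{√(-Δ) ∈ [N, 2N]}`. -/
def spectralProjection (N : ℝ) : L2 → L2 :=
  spectralMultiplier ((Icc N (2 * N)).indicator fun _ => 1)

/-- The linear flow `S_α(t) = exp(-i t (-Δ)^α)`. -/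
def flow (α t : ℝ) : L2 → L2 :=
  spectralMultiplier fun z => Complex.exp (-(Complex.I * t * ((z ^ (2 * α) : ℝ) : ℂ)))

/-- An element of `L²(Θ)` is radial. -/
def IsRadial (u : L2) : Prop :=
  ∃ g : ℝ → ℂ, ∀ᵐ x ∂diskMeasure, u x = g ‖x‖

/-- `G` is the weak gradient of `f` on `Θ`: `∫ f ∂ᵢφ = -∫ Gᵢ φ` for all `φ ∈ C_c^∞(Θ)`. -/
def IsWeakGradient (f : L2) (G : Plane → EuclideanSpace ℂ (Fin 2)) : Prop :=
  LocallyIntegrableOn G disk ∧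
    ∀ φ : Plane → ℝ, ContDiff ℝ ∞ φ → HasCompactSupport φ → tsupport φ ⊆ disk →
      ∀ i : Fin 2,
        ∫ x in disk, f x * ((fderiv ℝ φ x (EuclideanSpace.single i 1) : ℝ) : ℂ) =
          -∫ x in disk, G x i * ((φ x : ℝ) : ℂ)

/-- The norm of `L²_{t,x}((0,1) × Θ)`, with values in `[0, ∞]`. -/
def spaceTimeNorm {F : Type*} [NormedAddCommGroup F] (v : ℝ → Plane → F) : ℝ≥0∞ :=
  (∫⁻ t in Ioo (0 : ℝ) 1, ∫⁻ x in disk, ‖v t x‖ₑ ^ 2) ^ (1 / 2 : ℝ)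

end RadialDisk

end

/-!
Write `lam z = z ^ (2 * α)`. A function in the range of a dyadic spectral projection is a finite
combination of the orthonormal eigenfunctions (`orthonormal_eigenfun`, `exists_flow_eq_sum`), so
that at a point `x` the flow is the exponential sum `∑ c_z e_z(|x|) exp (-i t lam z)`. Two facts
carry the bilinear estimate.

* The frequencies `lam z` are separated: consecutive zeros of `J₀` have a gap bounded below
  (`exists_besselZeros_gap`), and `z ↦ z ^ (2 * α)` does not contract on `[1, ∞)` because `2α ≥ 1`.
  Hence the large sieve inequality `∫₀¹ |∑ aᵢ exp (-i t λᵢ)|² dt ≤ C ∑ |aᵢ|²` applies at each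
  fixed `x` (`exists_lintegral_expSum_sq_le`), and there are `O(N₂)` zeros in `[N₂, 2N₂]`.
* The normalized profiles satisfy `e_z(r)² ≤ C min (z, 1 / r)`, and their derivatives satisfy
  `(e_z'(r) / z)² ≤ C / r` (`exists_profile_bounds`).

The factor `u₂` is bounded uniformly in time by the Cauchy-Schwarz inequality, which costs the
number `O(N₂)` of its frequencies; the large sieve is applied to the other factor. What remains
is `∫ e_z² e_w² ≤ C ∫₀¹ min (w, 1 / r) dr`, or the same with a factor `z²` for the gradient. This
is logarithmic in `w`, and is bounded here through `min (w, 1 / r) ≤ w ^ θ r ^ (θ - 1)`; see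
`lintegral_expSum_mul_expSum_le`. The argument never compares `N₁` with `N₂`.

All information on `J₀` comes from its integral representation: it gives Bessel's equation in the
form `(x J₁)' = x J₀`, `J₀' = -J₁`, from which the decay `x^{-1/2}`, the matching lower bound for
`J₁` at the zeros of `J₀`, and the gap between zeros follow by the monotonicity of an energy.
The identities `∫₀¹ r J₀(zr)² dr = J₁(z)² / 2` and `∫₀¹ r J₀(ar) J₀(br) dr = 0` follow by exhibiting
primitives.

The eigenfunctions extend to continuously differentiable functions on the plane, so the explicit
gradient is a weak gradient, and weak gradients are unique almost everywhere.
-/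

noncomputable section

namespace RadialDisk

/-! ### Bessel functions through their integral representations -/

/-- The Bessel function of order one, `J₁ = -J₀'`, through its integral representation. -/
def besselJ1 (x : ℝ) : ℝ :=
  Real.pi⁻¹ * ∫ θ in (0 : ℝ)..Real.pi, Real.sin θ * Real.sin (x * Real.sin θ)

/-- The even continuous function `J₁(x) / x`, through its integral representation. -/
def besselK (x : ℝ) : ℝ :=
  Real.pi⁻¹ * ∫ θ in (0 : ℝ)..Real.pi, Real.cos θ ^ 2 * Real.cos (x * Real.sin θ)

theorem continuous_besselJ1 : Continuous besselJ1 := by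
  unfold besselJ1
  refine continuous_const.mul ?_
  exact intervalIntegral.continuous_parametric_intervalIntegral_of_continuous'
    (f := fun x θ => Real.sin θ * Real.sin (x * Real.sin θ)) (by fun_prop) 0 Real.pi

theorem continuous_besselK : Continuous besselK := by
  unfold besselK
  refine continuous_const.mul ?_
  exact intervalIntegral.continuous_parametric_intervalIntegral_of_continuous'
    (f := fun x θ => Real.cos θ ^ 2 * Real.cos (x * Real.sin θ)) (by fun_prop) 0 Real.pi

theorem hasDerivAt_besselJ0 (x : ℝ) : HasDerivAt besselJ0 (-besselJ1 x) x := by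
  have h := (intervalIntegral.hasDerivAt_integral_of_dominated_loc_of_deriv_le
    (μ := volume) (a := 0) (b := Real.pi) (x₀ := x) (s := univ) (bound := fun _ => 1)
    (F := fun x θ => Real.cos (x * Real.sin θ))
    (F' := fun x θ => -(Real.sin θ * Real.sin (x * Real.sin θ))) Filter.univ_mem
    (.of_forall fun y => by
      exact (Continuous.aestronglyMeasurable (by fun_prop)))
    (Continuous.intervalIntegrable (by fun_prop) _ _)
    (Continuous.aestronglyMeasurable (by fun_prop))
    (.of_forall fun θ _ y _ => by
      rw [norm_neg, norm_mul, Real.norm_eq_abs, Real.norm_eq_abs]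
      exact mul_le_one₀ (Real.abs_sin_le_one _) (abs_nonneg _) (Real.abs_sin_le_one _))
    (Continuous.intervalIntegrable (by fun_prop) _ _)
    (.of_forall fun θ _ y _ => by
      have h := ((hasDerivAt_id y).mul_const (Real.sin θ)).cos
      exact h.congr_deriv (by simp only [id]; ring))).2
  have h' := h.const_mul Real.pi⁻¹
  rw [intervalIntegral.integral_neg, mul_neg] at h'
  exact h'

/-- The derivative is `J₀(x) - J₁(x) / x`. -/
theorem hasDerivAt_besselJ1 (x : ℝ) : HasDerivAt besselJ1 (besselJ0 x - besselK x) x := by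
  have h := (intervalIntegral.hasDerivAt_integral_of_dominated_loc_of_deriv_le
    (μ := volume) (a := 0) (b := Real.pi) (x₀ := x) (s := univ) (bound := fun _ => 1)
    (F := fun x θ => Real.sin θ * Real.sin (x * Real.sin θ))
    (F' := fun x θ => Real.sin θ ^ 2 * Real.cos (x * Real.sin θ)) Filter.univ_mem
    (.of_forall fun y => by
      exact (Continuous.aestronglyMeasurable (by fun_prop)))
    (Continuous.intervalIntegrable (by fun_prop) _ _)
    (Continuous.aestronglyMeasurable (by fun_prop))
    (.of_forall fun θ _ y _ => by
      rw [norm_mul, Real.norm_eq_abs, Real.norm_eq_abs, abs_of_nonneg (sq_nonneg _)]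
      exact mul_le_one₀ (Real.sin_sq_le_one _) (abs_nonneg _) (Real.abs_cos_le_one _))
    (Continuous.intervalIntegrable (by fun_prop) _ _)
    (.of_forall fun θ _ y _ => by
      have h := (((hasDerivAt_id y).mul_const (Real.sin θ)).sin).const_mul (Real.sin θ)
      exact h.congr_deriv (by simp only [id]; ring))).2
  have h' := h.const_mul Real.pi⁻¹
  refine h'.congr_deriv ?_
  rw [besselJ0, besselK, ← mul_sub, ← intervalIntegral.integral_sub
    (Continuous.intervalIntegrable (by fun_prop) _ _)
    (Continuous.intervalIntegrable (by fun_prop) _ _)]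
  congr 1
  refine intervalIntegral.integral_congr fun θ _ => ?_
  simp only [Real.sin_sq]
  ring

theorem besselJ1_eq_mul (x : ℝ) : besselJ1 x = x * besselK x := by
  have h : ∫ θ in (0 : ℝ)..Real.pi, (-Real.sin θ * Real.sin (x * Real.sin θ) +
      Real.cos θ * (Real.cos (x * Real.sin θ) * (x * Real.cos θ))) = 0 := by
    rw [intervalIntegral.integral_eq_sub_of_hasDerivAt
      (f := fun θ => Real.cos θ * Real.sin (x * Real.sin θ))
      (fun θ _ => (Real.hasDerivAt_cos θ).mul ((Real.hasDerivAt_sin θ).const_mul x).sin)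
      (Continuous.intervalIntegrable (by fun_prop) _ _)]
    simp
  rw [intervalIntegral.integral_add (Continuous.intervalIntegrable (by fun_prop) _ _)
    (Continuous.intervalIntegrable (by fun_prop) _ _)] at h
  have h1 : ∫ θ in (0 : ℝ)..Real.pi, -Real.sin θ * Real.sin (x * Real.sin θ) =
      -∫ θ in (0 : ℝ)..Real.pi, Real.sin θ * Real.sin (x * Real.sin θ) := by
    rw [← intervalIntegral.integral_neg]
    simp only [neg_mul]
  have h2 : ∫ θ in (0 : ℝ)..Real.pi, Real.cos θ * (Real.cos (x * Real.sin θ) * (x * Real.cos θ)) =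
      x * ∫ θ in (0 : ℝ)..Real.pi, Real.cos θ ^ 2 * Real.cos (x * Real.sin θ) := by
    rw [← intervalIntegral.integral_const_mul]
    refine intervalIntegral.integral_congr fun θ _ => ?_
    ring
  rw [h1, h2] at h
  rw [besselJ1, besselK, neg_add_eq_zero.mp h]
  ring

/-- Bessel's equation in divergence form, `(x J₀')' = -x J₀`. -/
theorem hasDerivAt_mul_besselJ1 (x : ℝ) :
    HasDerivAt (fun x => x * besselJ1 x) (x * besselJ0 x) x := by
  have h := (hasDerivAt_id x).mul (hasDerivAt_besselJ1 x)
  refine h.congr_deriv ?_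
  rw [besselJ1_eq_mul, id]
  ring

theorem abs_besselJ0_le_one (x : ℝ) : |besselJ0 x| ≤ 1 := by
  have h := intervalIntegral.norm_integral_le_of_norm_le_const (a := 0) (b := Real.pi) (C := 1)
    (f := fun θ => Real.cos (x * Real.sin θ)) fun θ _ => Real.abs_cos_le_one _
  rw [besselJ0, abs_mul, abs_of_pos (inv_pos.mpr Real.pi_pos)]
  rw [Real.norm_eq_abs, sub_zero, abs_of_pos Real.pi_pos, one_mul] at h
  rw [inv_mul_le_iff₀ Real.pi_pos, mul_one]
  exact h

theorem abs_besselJ1_le_one (x : ℝ) : |besselJ1 x| ≤ 1 := by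
  have h := intervalIntegral.norm_integral_le_of_norm_le_const (a := 0) (b := Real.pi) (C := 1)
    (f := fun θ => Real.sin θ * Real.sin (x * Real.sin θ)) fun θ _ => by
      rw [norm_mul, Real.norm_eq_abs, Real.norm_eq_abs]
      exact mul_le_one₀ (Real.abs_sin_le_one _) (abs_nonneg _) (Real.abs_sin_le_one _)
  rw [besselJ1, abs_mul, abs_of_pos (inv_pos.mpr Real.pi_pos)]
  rw [Real.norm_eq_abs, sub_zero, abs_of_pos Real.pi_pos, one_mul] at h
  rw [inv_mul_le_iff₀ Real.pi_pos, mul_one]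
  exact h

theorem besselJ0_pos_of_le_one {x : ℝ} (hx : 0 ≤ x) (hx1 : x ≤ 1) : 0 < besselJ0 x := by
  refine mul_pos (inv_pos.mpr Real.pi_pos) ?_
  refine intervalIntegral.intervalIntegral_pos_of_pos_on
    (Continuous.intervalIntegrable (by fun_prop) _ _) (fun θ hθ => ?_) Real.pi_pos
  have h0 : 0 ≤ Real.sin θ := (Real.sin_pos_of_pos_of_lt_pi hθ.1 hθ.2).le
  have h1 : x * Real.sin θ ≤ 1 := mul_le_one₀ hx1 h0 (Real.sin_le_one θ)
  have h2 : 0 ≤ x * Real.sin θ := mul_nonneg hx h0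
  have := Real.pi_gt_three
  exact Real.cos_pos_of_mem_Ioo ⟨by linarith, by linarith⟩

theorem one_lt_of_mem_besselZeros {z : ℝ} (hz : z ∈ besselZeros) : 1 < z := by
  by_contra! h
  exact (besselJ0_pos_of_le_one hz.1.le h).ne' hz.2

/-! ### Energy of the Bessel equation: decay, and the gap between zeros -/

/-- The energy `w'² + (1 + 1 / (4x²)) w²` of the Liouville normal form `w = √x J₀(x)`, which
solves `w'' + (1 + 1 / (4x²)) w = 0`. -/
def besselEnergy (x : ℝ) : ℝ :=
  (besselJ0 x / 2 - x * besselJ1 x) ^ 2 / x + x * besselJ0 x ^ 2 + besselJ0 x ^ 2 / (4 * x)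

theorem hasDerivAt_besselEnergy {x : ℝ} (hx : 0 < x) :
    HasDerivAt besselEnergy (-(besselJ0 x ^ 2 / (2 * x ^ 2))) x := by
  have h0 := hasDerivAt_besselJ0 x
  have hp := hasDerivAt_mul_besselJ1 x
  have hi := hasDerivAt_id x
  have h1 := ((((h0.div_const 2).sub hp).pow 2).div hi hx.ne').add (hi.mul (h0.pow 2))
  have h2 := h1.add ((h0.pow 2).div (hi.const_mul 4) (by simp [hx.ne']))
  refine (h2.congr_deriv ?_).congr_of_eventuallyEq (.of_forall fun y => ?_)
  · simp
    field_simp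
    ring
  · simp [besselEnergy]

theorem mul_besselJ0_sq_le_energy {x : ℝ} (hx : 0 < x) : x * besselJ0 x ^ 2 ≤ besselEnergy x := by
  unfold besselEnergy
  have : 0 ≤ (besselJ0 x / 2 - x * besselJ1 x) ^ 2 / x := by positivity
  have : 0 ≤ besselJ0 x ^ 2 / (4 * x) := by positivity
  linarith

/-- With `a = J₀ / 2 - x J₁` and `b = J₀ / 2`, this is `(b - a)² ≤ 2 a² + 2 b²`. -/
theorem mul_besselJ1_sq_le_energy {x : ℝ} (hx : 0 < x) :
    x * besselJ1 x ^ 2 ≤ 4 * besselEnergy x := by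
  have h1 : x * besselJ1 x ^ 2 ≤
      2 * ((besselJ0 x / 2 - x * besselJ1 x) ^ 2 / x) + 2 * (besselJ0 x ^ 2 / (4 * x)) := by
    rw [← sub_nonneg]
    have : 2 * ((besselJ0 x / 2 - x * besselJ1 x) ^ 2 / x) + 2 * (besselJ0 x ^ 2 / (4 * x)) -
      x * besselJ1 x ^ 2 = (besselJ0 x - x * besselJ1 x) ^ 2 / x := by
      field_simp
      ring
    rw [this]
    positivity
  unfold besselEnergy
  have : 0 ≤ (besselJ0 x / 2 - x * besselJ1 x) ^ 2 / x := by positivity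
  have : 0 ≤ besselJ0 x ^ 2 / (4 * x) := by positivity
  have : 0 ≤ x * besselJ0 x ^ 2 := by positivity
  linarith

theorem besselEnergy_eq_of_zero {z : ℝ} (hz : z ∈ besselZeros) :
    besselEnergy z = z * besselJ1 z ^ 2 := by
  have := hz.1.ne'
  rw [besselEnergy, hz.2]
  field_simp
  ring

theorem besselEnergy_le {x : ℝ} (hx : 1 ≤ x) : besselEnergy x ≤ besselEnergy 1 := by
  refine antitoneOn_of_deriv_nonpos (convex_Ici (1 : ℝ))
    (fun y hy => (hasDerivAt_besselEnergy
      (lt_of_lt_of_le one_pos hy)).continuousAt.continuousWithinAt)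
    (fun y hy => ?_) (fun y hy => ?_) self_mem_Ici hx hx
  · rw [interior_Ici] at hy
    exact (hasDerivAt_besselEnergy (one_pos.trans hy)).differentiableAt.differentiableWithinAt
  · rw [interior_Ici] at hy
    rw [(hasDerivAt_besselEnergy (one_pos.trans hy)).deriv, neg_nonpos]
    positivity

/-- The energy does not decay: its logarithmic derivative is at least `-1 / (2x³)`, which is
integrable at infinity. -/
theorem le_besselEnergy {x : ℝ} (hx : 1 ≤ x) :
    besselEnergy 1 * Real.exp (-(1 / 4)) ≤ besselEnergy x := by
  have hd : ∀ y : ℝ, 0 < y →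
      HasDerivAt (fun y => besselEnergy y * Real.exp (-(y ^ 2)⁻¹ / 4))
        (Real.exp (-(y ^ 2)⁻¹ / 4) / (2 * y ^ 3) * (besselEnergy y - y * besselJ0 y ^ 2)) y := by
    intro y hy
    have h1 := (((((hasDerivAt_id y).pow 2).inv (by simp [hy.ne'])).neg).div_const 4).exp
    refine ((hasDerivAt_besselEnergy hy).mul h1).congr_deriv ?_
    simp
    field_simp
    ring
  have hmono : MonotoneOn (fun y => besselEnergy y * Real.exp (-(y ^ 2)⁻¹ / 4)) (Ici 1) := by
    refine monotoneOn_of_deriv_nonneg (convex_Ici (1 : ℝ))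
      (fun y hy => (hd y (lt_of_lt_of_le one_pos hy)).continuousAt.continuousWithinAt)
      (fun y hy => ?_) (fun y hy => ?_)
    · rw [interior_Ici] at hy
      exact (hd y (one_pos.trans hy)).differentiableAt.differentiableWithinAt
    · rw [interior_Ici] at hy
      have hy0 : 0 < y := one_pos.trans hy
      rw [(hd y hy0).deriv]
      exact mul_nonneg (by positivity) (sub_nonneg.mpr (mul_besselJ0_sq_le_energy hy0))
  have h := hmono self_mem_Ici hx hx
  have hx0 : 0 < x := by linarith
  have hE : 0 ≤ besselEnergy x := le_trans (by positivity) (mul_besselJ0_sq_le_energy hx0)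
  calc besselEnergy 1 * Real.exp (-(1 / 4))
      = besselEnergy 1 * Real.exp (-((1 : ℝ) ^ 2)⁻¹ / 4) := by norm_num
    _ ≤ besselEnergy x * Real.exp (-(x ^ 2)⁻¹ / 4) := h
    _ ≤ besselEnergy x * 1 := by
        gcongr
        rw [Real.exp_le_one_iff]
        have : 0 ≤ (x ^ 2)⁻¹ := by positivity
        linarith
    _ = besselEnergy x := mul_one _

theorem besselEnergy_one_pos : 0 < besselEnergy 1 := by
  have h := besselJ0_pos_of_le_one zero_le_one le_rfl
  have := mul_besselJ0_sq_le_energy one_pos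
  have : 0 < besselJ0 1 ^ 2 := by positivity
  linarith

theorem exists_bessel_decay :
    ∃ C : ℝ, 0 < C ∧ ∀ x : ℝ, 0 < x → x * besselJ0 x ^ 2 ≤ C ∧ x * besselJ1 x ^ 2 ≤ C := by
  have hE := besselEnergy_one_pos
  refine ⟨4 * besselEnergy 1 + 1, by linarith, fun x hx => ?_⟩
  rcases le_total x 1 with h | h
  · have h0 : besselJ0 x ^ 2 ≤ 1 := (sq_le_one_iff_abs_le_one _).mpr (abs_besselJ0_le_one x)
    have h1 : besselJ1 x ^ 2 ≤ 1 := (sq_le_one_iff_abs_le_one _).mpr (abs_besselJ1_le_one x)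
    have h0' := mul_le_one₀ h (sq_nonneg _) h0
    have h1' := mul_le_one₀ h (sq_nonneg _) h1
    constructor <;> linarith
  · have h1 := mul_besselJ0_sq_le_energy hx
    have h2 := mul_besselJ1_sq_le_energy hx
    have h3 := besselEnergy_le h
    constructor <;> linarith

theorem exists_le_mul_besselJ1_sq :
    ∃ c : ℝ, 0 < c ∧ ∀ z ∈ besselZeros, c ≤ z * besselJ1 z ^ 2 :=
  ⟨besselEnergy 1 * Real.exp (-(1 / 4)), mul_pos besselEnergy_one_pos (Real.exp_pos _),
    fun _ hz => besselEnergy_eq_of_zero hz ▸ le_besselEnergy (one_lt_of_mem_besselZeros hz).le⟩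

/-- Between two zeros of `J₀` there is a zero of `x J₁(x)`, a function of size `√z` at the zero `z`
and with derivative `x J₀(x) = O(√x)`. -/
theorem exists_besselZeros_gap :
    ∃ δ : ℝ, 0 < δ ∧ ∀ z ∈ besselZeros, ∀ z' ∈ besselZeros, z < z' → δ ≤ z' - z := by
  obtain ⟨C, hC, hdecay⟩ := exists_bessel_decay
  obtain ⟨c, hc, hlow⟩ := exists_le_mul_besselJ1_sq
  refine ⟨min 1 (√(c / (2 * C))), by positivity, fun z hz z' hz' hlt => ?_⟩
  by_contra! hcon
  rw [lt_min_iff] at hcon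
  have hz1 := one_lt_of_mem_besselZeros hz
  obtain ⟨y, hy, hy0⟩ := exists_hasDerivAt_eq_zero hlt
    (continuous_besselJ0.continuousOn) (hz.2.trans hz'.2.symm)
    (fun x _ => hasDerivAt_besselJ0 x)
  obtain ⟨s, hs, hs0⟩ := exists_hasDerivAt_eq_slope (fun x => x * besselJ1 x)
    (fun x => x * besselJ0 x) hy.1 (by
      exact (continuous_id.mul continuous_besselJ1).continuousOn)
    (fun x _ => hasDerivAt_mul_besselJ1 x)
  have hJ : besselJ1 y = 0 := neg_eq_zero.mp hy0
  have hs2 : s ≤ 2 * z := by linarith [hs.2, hy.2, hcon.1]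
  have hsp : 0 < s := by linarith [hs.1]
  have hyz : 0 < y - z := sub_pos.mpr hy.1
  have key : (z * besselJ1 z) ^ 2 = (s * besselJ0 s) ^ 2 * (y - z) ^ 2 := by
    rw [hs0, hJ]
    field_simp
    ring
  have h1 : c * z ≤ (z * besselJ1 z) ^ 2 := by
    nlinarith [hlow z hz, hz.1]
  have h2 : (s * besselJ0 s) ^ 2 ≤ 2 * z * C := by
    calc (s * besselJ0 s) ^ 2 = s * (s * besselJ0 s ^ 2) := by ring
      _ ≤ s * C := by gcongr; exact (hdecay s hsp).1
      _ ≤ 2 * z * C := by gcongr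
  have h3 : (y - z) ^ 2 < c / (2 * C) := by
    have : y - z < √(c / (2 * C)) := by linarith [hcon.2, hy.2]
    exact (Real.lt_sqrt hyz.le).mp this
  have h4 : c * z < c * z := calc
    c * z ≤ (s * besselJ0 s) ^ 2 * (y - z) ^ 2 := key ▸ h1
    _ ≤ 2 * z * C * (y - z) ^ 2 := by gcongr
    _ < 2 * z * C * (c / (2 * C)) := by
        have := hz.1
        gcongr
    _ = c * z := by field_simp
  exact lt_irrefl _ h4

/-! ### Integrals of Bessel functions -/

theorem integral_mul_besselJ0_sq {z : ℝ} (hz : z ∈ besselZeros) :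
    ∫ r in (0 : ℝ)..1, r * (besselJ0 (z * r) * besselJ0 (z * r)) = besselJ1 z ^ 2 / 2 := by
  have hz0 := hz.1.ne'
  have hd : ∀ r : ℝ, HasDerivAt (fun r => ((z * r * besselJ1 (z * r)) ^ 2 +
      (z * r * besselJ0 (z * r)) ^ 2) / (2 * z ^ 2))
      (r * (besselJ0 (z * r) * besselJ0 (z * r))) r := by
    intro r
    have hi := (hasDerivAt_id r).const_mul z
    have hp := (hasDerivAt_mul_besselJ1 (z * r)).comp r hi
    have h0 := (hasDerivAt_besselJ0 (z * r)).comp r hi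
    have h := ((hp.pow 2).add ((hi.mul h0).pow 2)).div_const (2 * z ^ 2)
    refine h.congr_deriv ?_
    simp
    field_simp
    ring
  rw [intervalIntegral.integral_eq_sub_of_hasDerivAt (fun r _ => hd r)]
  · simp [hz.2]
    field_simp
  · have := continuous_besselJ0
    exact Continuous.intervalIntegrable (by fun_prop) _ _

theorem integral_mul_besselJ0_mul {a b : ℝ} (ha : a ∈ besselZeros) (hb : b ∈ besselZeros)
    (hab : a ≠ b) : ∫ r in (0 : ℝ)..1, r * (besselJ0 (a * r) * besselJ0 (b * r)) = 0 := by
  have hne : a ^ 2 - b ^ 2 ≠ 0 := by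
    rw [sub_ne_zero]
    exact fun h => hab ((sq_eq_sq₀ ha.1.le hb.1.le).mp h)
  have hd : ∀ r : ℝ, HasDerivAt (fun r => (a * r * besselJ1 (a * r) * besselJ0 (b * r) -
      b * r * besselJ1 (b * r) * besselJ0 (a * r)) / (a ^ 2 - b ^ 2))
      (r * (besselJ0 (a * r) * besselJ0 (b * r))) r := by
    intro r
    have hia := (hasDerivAt_id r).const_mul a
    have hib := (hasDerivAt_id r).const_mul b
    have hpa := (hasDerivAt_mul_besselJ1 (a * r)).comp r hia
    have h0a := (hasDerivAt_besselJ0 (a * r)).comp r hia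
    have hpb := (hasDerivAt_mul_besselJ1 (b * r)).comp r hib
    have h0b := (hasDerivAt_besselJ0 (b * r)).comp r hib
    have h := ((hpa.mul h0b).sub (hpb.mul h0a)).div_const (a ^ 2 - b ^ 2)
    refine h.congr_deriv ?_
    simp
    field_simp
    ring
  rw [intervalIntegral.integral_eq_sub_of_hasDerivAt (fun r _ => hd r)]
  · simp [ha.2, hb.2]
  · have := continuous_besselJ0
    exact Continuous.intervalIntegrable (by fun_prop) _ _

/-! ### Gaussian sums over separated points -/

theorem summable_exp_neg_mul_sq {δ : ℝ} (hδ : 0 < δ) :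
    Summable fun n : ℕ => Real.exp (-(δ * n) ^ 2 / 4) := by
  have h : Summable fun n : ℕ => Real.exp (n * (-(δ ^ 2 / 4))) :=
    Real.summable_exp_nat_mul_iff.mpr (by have := pow_pos hδ 2; linarith)
  refine h.of_nonneg_of_le (fun n => (Real.exp_pos _).le) fun n => Real.exp_le_exp.mpr ?_
  have h1 : (n : ℝ) ≤ (n : ℝ) ^ 2 := by
    exact_mod_cast Nat.le_self_pow two_ne_zero n
  have h2 := mul_le_mul_of_nonneg_left h1 (by positivity : 0 ≤ δ ^ 2 / 4)
  linarith [mul_pow δ (n : ℝ) 2]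

/-- Gaussian sums over `δ`-separated points are bounded by a constant depending only on `δ`. -/
theorem exists_sum_gaussian_le {δ : ℝ} (hδ : 0 < δ) :
    ∃ C : ℝ, 0 < C ∧ ∀ (ι : Type) (S : Finset ι) (lam : ι → ℝ),
      (∀ i ∈ S, ∀ j ∈ S, i ≠ j → δ ≤ |lam i - lam j|) →
      ∀ μ : ℝ, ∑ i ∈ S, Real.exp (-(lam i - μ) ^ 2 / 4) ≤ C := by
  -- `g k` bounds the Gaussian on the cell `[δ k, δ (k + 1))`, which contains at most one point.
  let g : ℤ → ℝ := fun k =>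
    if 0 ≤ k then Real.exp (-(δ * k) ^ 2 / 4) else Real.exp (-(δ * (k + 1)) ^ 2 / 4)
  have hg0 : ∀ k, 0 ≤ g k := fun k => by
    dsimp only [g]
    split_ifs <;> exact (Real.exp_pos _).le
  have hg : Summable g := by
    refine Summable.of_nat_of_neg_add_one ?_ ?_
    · refine (summable_exp_neg_mul_sq hδ).congr fun n => ?_
      simp [g]
    · refine (summable_exp_neg_mul_sq hδ).congr fun n => ?_
      have : ¬ (0 : ℤ) ≤ -(n + 1) := by omega
      simp only [g, this, if_false]
      congr 1
      push_cast
      ring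
  refine ⟨(∑' k, g k) + 1, by
    have : 0 ≤ ∑' k, g k := tsum_nonneg hg0
    linarith, fun ι S lam hsep μ => ?_⟩
  let κ : ι → ℤ := fun i => ⌊(lam i - μ) / δ⌋
  have hinj : Set.InjOn κ S := by
    intro i hi j hj hij
    by_contra hne
    have h1 := Int.abs_sub_lt_one_of_floor_eq_floor hij
    have h2 := hsep i hi j hj hne
    rw [← sub_div, abs_div, abs_of_pos hδ, div_lt_one hδ, sub_sub_sub_cancel_right] at h1
    linarith
  have hle : ∀ i, Real.exp (-(lam i - μ) ^ 2 / 4) ≤ g (κ i) := by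
    intro i
    have h1 : δ * (κ i : ℝ) ≤ lam i - μ := by
      rw [mul_comm, ← le_div_iff₀ hδ]
      exact Int.floor_le _
    have h2 : lam i - μ ≤ δ * ((κ i : ℝ) + 1) := by
      rw [mul_comm, ← div_le_iff₀ hδ]
      exact (Int.lt_floor_add_one _).le
    dsimp only [g]
    split_ifs with hk
    · have hk' : (0 : ℝ) ≤ κ i := by exact_mod_cast hk
      have : 0 ≤ δ * (κ i : ℝ) := by positivity
      refine Real.exp_le_exp.mpr ?_
      nlinarith
    · have hk' : (κ i : ℝ) + 1 ≤ 0 := by exact_mod_cast (by omega : κ i + 1 ≤ 0)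
      have : δ * ((κ i : ℝ) + 1) ≤ 0 := mul_nonpos_of_nonneg_of_nonpos hδ.le hk'
      refine Real.exp_le_exp.mpr ?_
      nlinarith
  classical
  calc ∑ i ∈ S, Real.exp (-(lam i - μ) ^ 2 / 4) ≤ ∑ i ∈ S, g (κ i) :=
        Finset.sum_le_sum fun i _ => hle i
    _ = ∑ k ∈ S.image κ, g k := (Finset.sum_image hinj).symm
    _ ≤ ∑' k, g k := hg.sum_le_tsum _ fun k _ => hg0 k
    _ ≤ (∑' k, g k) + 1 := by linarith

/-! ### The large sieve inequality -/

/-- The exponential polynomial `∑ aᵢ exp (-i t λᵢ)`. -/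
def expSum {ι : Type} (S : Finset ι) (lam : ι → ℝ) (a : ι → ℂ) (t : ℝ) : ℂ :=
  ∑ i ∈ S, a i * Complex.exp (-(Complex.I * t * (lam i : ℂ)))

theorem integral_gaussian_mul_exp (μ : ℝ) :
    ∫ t : ℝ, Complex.exp (Complex.I * t * μ) * Complex.exp (-t ^ 2) =
      ((√Real.pi * Real.exp (-μ ^ 2 / 4) : ℝ) : ℂ) := by
  have h := fourierIntegral_gaussian (b := 1) (by simp) (μ : ℂ)
  simp only [div_one, mul_one, neg_mul, one_mul] at h
  have h2 : ((Real.pi : ℂ)) ^ (1 / 2 : ℂ) = ((√Real.pi : ℝ) : ℂ) := by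
    rw [Real.sqrt_eq_rpow, Complex.ofReal_cpow Real.pi_pos.le]
    norm_num
  rw [h2] at h
  push_cast
  rw [← h]
  refine integral_congr_ae (.of_forall fun t => ?_)
  dsimp only
  rw [mul_right_comm]

/-- A consequence of the value of the integral: it is nonzero, while the Bochner integral of a
non-integrable function is `0`. -/
theorem integrable_gaussian_mul_exp (μ : ℝ) :
    Integrable fun t : ℝ => Complex.exp (Complex.I * t * μ) * Complex.exp (-t ^ 2) := by
  by_contra h
  have h1 := integral_gaussian_mul_exp μ
  rw [integral_undef h] at h1
  have : (0 : ℝ) < √Real.pi * Real.exp (-μ ^ 2 / 4) :=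
    mul_pos (Real.sqrt_pos.mpr Real.pi_pos) (Real.exp_pos _)
  exact this.ne (by exact_mod_cast h1)

/-- The large sieve inequality for separated frequencies: the indicator of `(0, 1)` is dominated by
a Gaussian, whose Fourier transform makes the exponentials almost orthogonal. -/
theorem exists_lintegral_expSum_sq_le {δ : ℝ} (hδ : 0 < δ) :
    ∃ C : ℝ, 0 < C ∧ ∀ (ι : Type) (S : Finset ι) (lam : ι → ℝ),
      (∀ i ∈ S, ∀ j ∈ S, i ≠ j → δ ≤ |lam i - lam j|) →
      ∀ a : ι → ℂ, ∫⁻ t in Ioo (0 : ℝ) 1, ‖expSum S lam a t‖ₑ ^ 2 ≤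
        ENNReal.ofReal (C * ∑ i ∈ S, ‖a i‖ ^ 2) := by
  obtain ⟨C, hC, hsum⟩ := exists_sum_gaussian_le hδ
  refine ⟨Real.exp 1 * (√Real.pi * C), by positivity, fun ι S lam hsep a => ?_⟩
  have hexp : ∀ t : ℝ, (((Real.exp (-t ^ 2) * ‖expSum S lam a t‖ ^ 2 : ℝ)) : ℂ) =
      ∑ i ∈ S, ∑ j ∈ S, a i * (starRingEnd ℂ) (a j) *
        (Complex.exp (Complex.I * t * ((lam j - lam i : ℝ) : ℂ)) * Complex.exp (-t ^ 2)) := by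
    intro t
    push_cast
    rw [← Complex.mul_conj', expSum, map_sum, Finset.sum_mul_sum, Finset.mul_sum]
    refine Finset.sum_congr rfl fun i _ => ?_
    rw [Finset.mul_sum]
    refine Finset.sum_congr rfl fun j _ => ?_
    rw [map_mul, ← Complex.exp_conj]
    simp only [map_neg, map_mul, Complex.conj_I, Complex.conj_ofReal]
    have : Complex.exp (Complex.I * t * (lam j - lam i)) =
        Complex.exp (-(Complex.I * t * lam i)) * Complex.exp (-(-Complex.I * t * lam j)) := by
      rw [← Complex.exp_add]
      ring_nf
    rw [this]
    ring
  have hint : Integrable fun t : ℝ =>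
      (((Real.exp (-t ^ 2) * ‖expSum S lam a t‖ ^ 2 : ℝ)) : ℂ) := by
    simp_rw [hexp]
    exact integrable_finsetSum _ fun i _ => integrable_finsetSum _ fun j _ =>
      (integrable_gaussian_mul_exp _).const_mul _
  have hintR : Integrable fun t : ℝ => Real.exp (-t ^ 2) * ‖expSum S lam a t‖ ^ 2 := by
    exact hint.re.congr (.of_forall fun t => Complex.ofReal_re _)
  have hval : ∫ t : ℝ, Real.exp (-t ^ 2) * ‖expSum S lam a t‖ ^ 2 ≤
      √Real.pi * C * ∑ i ∈ S, ‖a i‖ ^ 2 := by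
    let k : ι → ι → ℝ := fun i j => √Real.pi * Real.exp (-(lam j - lam i) ^ 2 / 4)
    have hk0 : ∀ i j, 0 ≤ k i j := fun i j => by positivity
    have hks : ∀ i j, k i j = k j i := fun i j => by
      dsimp only [k]
      rw [← neg_sub, neg_sq]
    have hkC : ∀ i, ∑ j ∈ S, k i j ≤ √Real.pi * C := fun i => by
      rw [← Finset.mul_sum]
      exact mul_le_mul_of_nonneg_left (hsum ι S lam hsep (lam i)) (Real.sqrt_nonneg _)
    have h1 : ((∫ t : ℝ, Real.exp (-t ^ 2) * ‖expSum S lam a t‖ ^ 2 : ℝ) : ℂ) =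
        ∑ i ∈ S, ∑ j ∈ S, a i * (starRingEnd ℂ) (a j) * (k i j : ℂ) := by
      rw [← integral_complex_ofReal]
      simp_rw [hexp]
      rw [integral_finsetSum _ fun i _ => integrable_finsetSum _ fun j _ =>
        (integrable_gaussian_mul_exp _).const_mul _]
      refine Finset.sum_congr rfl fun i _ => ?_
      rw [integral_finsetSum _ fun j _ => (integrable_gaussian_mul_exp _).const_mul _]
      refine Finset.sum_congr rfl fun j _ => ?_
      rw [integral_const_mul, integral_gaussian_mul_exp]
    calc ∫ t : ℝ, Real.exp (-t ^ 2) * ‖expSum S lam a t‖ ^ 2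
        ≤ ‖((∫ t : ℝ, Real.exp (-t ^ 2) * ‖expSum S lam a t‖ ^ 2 : ℝ) : ℂ)‖ := by
          rw [Complex.norm_real]
          exact le_abs_self _
      _ ≤ ∑ i ∈ S, ∑ j ∈ S, ‖a i‖ * ‖a j‖ * k i j := by
          rw [h1]
          refine (norm_sum_le _ _).trans (Finset.sum_le_sum fun i _ => ?_)
          refine (norm_sum_le _ _).trans (Finset.sum_le_sum fun j _ => ?_)
          rw [norm_mul, norm_mul, RCLike.norm_conj, Complex.norm_real, Real.norm_eq_abs,
            abs_of_nonneg (hk0 i j)]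
      _ ≤ ∑ i ∈ S, ∑ j ∈ S, (‖a i‖ ^ 2 / 2 * k i j + ‖a j‖ ^ 2 / 2 * k i j) := by
          refine Finset.sum_le_sum fun i _ => Finset.sum_le_sum fun j _ => ?_
          rw [← add_mul]
          refine mul_le_mul_of_nonneg_right ?_ (hk0 i j)
          nlinarith [sq_nonneg (‖a i‖ - ‖a j‖)]
      _ = ∑ i ∈ S, ‖a i‖ ^ 2 * ∑ j ∈ S, k i j := by
          simp_rw [Finset.sum_add_distrib]
          nth_rewrite 2 [Finset.sum_comm]
          rw [← Finset.sum_add_distrib]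
          refine Finset.sum_congr rfl fun i _ => ?_
          rw [Finset.mul_sum, ← Finset.sum_add_distrib]
          refine Finset.sum_congr rfl fun j _ => ?_
          rw [hks j i]
          ring
      _ ≤ ∑ i ∈ S, ‖a i‖ ^ 2 * (√Real.pi * C) :=
          Finset.sum_le_sum fun i _ => mul_le_mul_of_nonneg_left (hkC i) (sq_nonneg _)
      _ = √Real.pi * C * ∑ i ∈ S, ‖a i‖ ^ 2 := by rw [← Finset.sum_mul, mul_comm]
  calc ∫⁻ t in Ioo (0 : ℝ) 1, ‖expSum S lam a t‖ₑ ^ 2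
      ≤ ∫⁻ t in Ioo (0 : ℝ) 1,
          ENNReal.ofReal (Real.exp 1 * (Real.exp (-t ^ 2) * ‖expSum S lam a t‖ ^ 2)) := by
        refine setLIntegral_mono' measurableSet_Ioo fun t ht => ?_
        rw [← ofReal_norm, ← ENNReal.ofReal_pow (norm_nonneg _)]
        refine ENNReal.ofReal_le_ofReal ?_
        rw [← mul_assoc, ← Real.exp_add]
        refine le_mul_of_one_le_left (sq_nonneg _) (Real.one_le_exp ?_)
        nlinarith [ht.1, ht.2]
    _ ≤ ∫⁻ t, ENNReal.ofReal (Real.exp 1 * (Real.exp (-t ^ 2) * ‖expSum S lam a t‖ ^ 2)) :=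
        setLIntegral_le_lintegral _ _
    _ = ENNReal.ofReal (∫ t, Real.exp 1 * (Real.exp (-t ^ 2) * ‖expSum S lam a t‖ ^ 2)) := by
        rw [ofReal_integral_eq_lintegral_ofReal (hintR.const_mul _)]
        exact .of_forall fun t => by positivity
    _ ≤ ENNReal.ofReal (Real.exp 1 * (√Real.pi * C) * ∑ i ∈ S, ‖a i‖ ^ 2) := by
        refine ENNReal.ofReal_le_ofReal ?_
        rw [integral_const_mul, mul_assoc]
        exact mul_le_mul_of_nonneg_left hval (Real.exp_pos _).le

/-! ### Polar coordinates and orthonormality of the eigenfunctions -/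

/-- The length `2π` of the unit circle, as it comes out of Mathlib's polar coordinates. -/
def circleLength : ℝ := 2 * (volume : Measure Plane).real (Metric.ball 0 1)

theorem circleLength_pos : 0 < circleLength :=
  mul_pos two_pos (ENNReal.toReal_pos (Metric.measure_ball_pos _ _ one_pos).ne'
    measure_ball_lt_top.ne)

theorem setIntegral_disk_norm (f : ℝ → ℝ) :
    ∫ x in disk, f ‖x‖ = circleLength * ∫ r in (0 : ℝ)..1, r * f r := by
  have h := integral_fun_norm_addHaar (volume : Measure Plane) ((Iio (1 : ℝ)).indicator f)
  have h1 : ∀ x : Plane, (Iio (1 : ℝ)).indicator f ‖x‖ = disk.indicator (fun x => f ‖x‖) x := by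
    intro x
    simp [indicator, disk]
  simp_rw [h1] at h
  rw [integral_indicator (by exact measurableSet_ball)] at h
  rw [h, circleLength, intervalIntegral.integral_of_le zero_le_one, integral_Ioc_eq_integral_Ioo]
  have h2 : ∀ y : ℝ, y ^ (Module.finrank ℝ Plane - 1) • (Iio (1 : ℝ)).indicator f y =
      (Iio (1 : ℝ)).indicator (fun y => y * f y) y := by
    intro y
    by_cases hy : y ∈ Iio (1 : ℝ) <;> simp [hy]
  simp_rw [h2]
  rw [setIntegral_indicator measurableSet_Iio, Ioi_inter_Iio]
  simp [mul_assoc]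

theorem lintegral_disk_norm_rpow {θ : ℝ} (hθ : 0 < θ) :
    ∫⁻ x in disk, ENNReal.ofReal (‖x‖ ^ (θ - 2)) = ENNReal.ofReal (circleLength / θ) := by
  have hpow : ∀ r ∈ Ioo (0 : ℝ) 1, r * r ^ (θ - 2) = r ^ (θ - 1) := fun r hr => by
    rw [show θ - 1 = 1 + (θ - 2) by ring, Real.rpow_add hr.1, Real.rpow_one]
  have hint : IntegrableOn (fun x : Plane => ‖x‖ ^ (θ - 2)) disk := by
    unfold disk
    rw [integrableOn_fun_norm_addHaar (volume : Measure Plane) (f := fun r => r ^ (θ - 2))]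
    have h : IntegrableOn (fun r : ℝ => r ^ (θ - 1)) (Ioo 0 1) :=
      ((intervalIntegral.intervalIntegrable_rpow' (by linarith)).1).mono_set Ioo_subset_Ioc_self
    refine h.congr_fun (fun r hr => ?_) measurableSet_Ioo
    simp [hpow r hr]
  rw [← ofReal_integral_eq_lintegral_ofReal hint
    (.of_forall fun x => Real.rpow_nonneg (norm_nonneg _) _)]
  rw [setIntegral_disk_norm (fun r => r ^ (θ - 2)),
    intervalIntegral.integral_of_le zero_le_one, integral_Ioc_eq_integral_Ioo,
    setIntegral_congr_fun measurableSet_Ioo hpow, ← integral_Ioc_eq_integral_Ioo,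
    ← intervalIntegral.integral_of_le zero_le_one, integral_rpow (.inl (by linarith))]
  simp [hθ.ne', div_eq_mul_inv]

theorem inner_besselModeL2 (a b : ℝ) :
    inner ℂ (besselModeL2 a) (besselModeL2 b) =
      ((circleLength * ∫ r in (0 : ℝ)..1, r * (besselJ0 (a * r) * besselJ0 (b * r)) : ℝ) : ℂ) := by
  rw [← setIntegral_disk_norm (fun r => besselJ0 (a * r) * besselJ0 (b * r)), L2.inner_def,
    ← integral_complex_ofReal]
  refine integral_congr_ae ?_
  filter_upwards [(memLp_besselMode a).coeFn_toLp, (memLp_besselMode b).coeFn_toLp] with x ha hb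
  rw [besselModeL2, besselModeL2, ha, hb]
  simp [besselMode, mul_comm]

theorem norm_besselModeL2_sq {z : ℝ} (hz : z ∈ besselZeros) :
    ‖besselModeL2 z‖ ^ 2 = circleLength / 2 * besselJ1 z ^ 2 := by
  have h := inner_self_eq_norm_sq_to_K (𝕜 := ℂ) (besselModeL2 z)
  rw [inner_besselModeL2, integral_mul_besselJ0_sq hz] at h
  have h' : circleLength * (besselJ1 z ^ 2 / 2) = ‖besselModeL2 z‖ ^ 2 := by
    apply Complex.ofReal_injective
    rw [h]
    simp
  rw [← h']
  ring

theorem exists_le_mul_norm_besselModeL2_sq :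
    ∃ c : ℝ, 0 < c ∧ ∀ z ∈ besselZeros, c ≤ z * ‖besselModeL2 z‖ ^ 2 := by
  obtain ⟨c, hc, h⟩ := exists_le_mul_besselJ1_sq
  refine ⟨circleLength / 2 * c, mul_pos (half_pos circleLength_pos) hc, fun z hz => ?_⟩
  rw [norm_besselModeL2_sq hz, mul_left_comm]
  exact mul_le_mul_of_nonneg_left (h z hz) (half_pos circleLength_pos).le

theorem norm_besselModeL2_pos {z : ℝ} (hz : z ∈ besselZeros) : 0 < ‖besselModeL2 z‖ := by
  obtain ⟨c, hc, h⟩ := exists_le_mul_norm_besselModeL2_sq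
  refine (norm_nonneg _).lt_of_ne fun h0 => ?_
  have := h z hz
  rw [← h0] at this
  norm_num at this
  linarith

theorem orthonormal_eigenfun : Orthonormal ℂ fun z : besselZeros => eigenfun z := by
  refine ⟨fun z => ?_, fun a b hab => ?_⟩
  · have h := norm_besselModeL2_pos z.2
    change ‖eigenfun z‖ = 1
    rw [eigenfun, norm_smul, Complex.norm_real, norm_inv, norm_norm, inv_mul_cancel₀ h.ne']
  · change inner ℂ (eigenfun a) (eigenfun b) = 0
    rw [eigenfun, eigenfun, inner_smul_left, inner_smul_right, inner_besselModeL2,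
      integral_mul_besselJ0_mul a.2 b.2 (fun h => hab (Subtype.ext h))]
    simp

/-! ### Bounds for the radial profiles -/

/-- The radial profile `J₀(z r) / ‖J₀(z |·|)‖` of the eigenfunction `eigenfun z`. -/
def profile (z r : ℝ) : ℝ := ‖besselModeL2 z‖⁻¹ * besselJ0 (z * r)

/-- The profile `J₁(z r) / ‖J₀(z |·|)‖`, which is `-1 / z` times the derivative of `profile z`. -/
def gradProfile (z r : ℝ) : ℝ := ‖besselModeL2 z‖⁻¹ * besselJ1 (z * r)

theorem continuous_profile (z : ℝ) : Continuous (profile z) :=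
  continuous_const.mul (continuous_besselJ0.comp (continuous_const.mul continuous_id))

theorem continuous_gradProfile (z : ℝ) : Continuous (gradProfile z) :=
  continuous_const.mul (continuous_besselJ1.comp (continuous_const.mul continuous_id))

theorem eigenfun_ae_eq (z : ℝ) :
    eigenfun z =ᵐ[diskMeasure] fun x => ((profile z ‖x‖ : ℝ) : ℂ) := by
  filter_upwards [Lp.coeFn_smul ((‖besselModeL2 z‖⁻¹ : ℝ) : ℂ) (besselModeL2 z),
    (memLp_besselMode z).coeFn_toLp] with x h1 h2
  rw [eigenfun, h1, Pi.smul_apply, besselModeL2, h2]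
  simp [besselMode, profile, besselModeL2]

theorem exists_profile_bounds :
    ∃ K : ℝ, 0 < K ∧ ∀ z ∈ besselZeros, ∀ r : ℝ, 0 < r →
      profile z r ^ 2 ≤ K / r ∧ gradProfile z r ^ 2 ≤ K / r ∧ profile z r ^ 2 ≤ K * z := by
  obtain ⟨C, hC, hdecay⟩ := exists_bessel_decay
  obtain ⟨c, hc, hlow⟩ := exists_le_mul_norm_besselModeL2_sq
  have key : ∀ z ∈ besselZeros, ∀ r : ℝ, 0 < r → ∀ y : ℝ, z * r * y ^ 2 ≤ C →
      (‖besselModeL2 z‖⁻¹ * y) ^ 2 ≤ (C + 1) / c / r := by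
    intro z hz r hr y hy
    have hn := norm_besselModeL2_pos hz
    have hz0 := hz.1
    rw [mul_pow, inv_pow, inv_mul_le_iff₀ (by positivity), div_div, mul_div_assoc',
      le_div_iff₀ (by positivity)]
    refine le_of_mul_le_mul_left ?_ hz0
    have h1 := hlow z hz
    have h2 : z * r * y ^ 2 * c ≤ C * (z * ‖besselModeL2 z‖ ^ 2) := by gcongr
    have h3 : 0 ≤ z * ‖besselModeL2 z‖ ^ 2 := by positivity
    nlinarith
  refine ⟨(C + 1) / c, by positivity, fun z hz r hr => ⟨?_, ?_, ?_⟩⟩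
  · exact key z hz r hr _ (hdecay _ (mul_pos hz.1 hr)).1
  · exact key z hz r hr _ (hdecay _ (mul_pos hz.1 hr)).2
  · have hn := norm_besselModeL2_pos hz
    have hz0 := hz.1
    rw [profile, mul_pow, inv_pow, inv_mul_le_iff₀ (by positivity), mul_comm (_ / _), ← mul_assoc,
      mul_div_assoc', le_div_iff₀ hc]
    have h1 := hlow z hz
    have h2 : besselJ0 (z * r) ^ 2 ≤ 1 := (sq_le_one_iff_abs_le_one _).mpr (abs_besselJ0_le_one _)
    nlinarith [mul_nonneg hz0.le (sq_nonneg ‖besselModeL2 z‖)]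

/-- Interpolation between the bounds `profile z r ^ 2 ≲ z` and `profile z r ^ 2 ≲ 1 / r`. -/
theorem profile_sq_le_rpow {K z r θ : ℝ} (hK : 0 < K) (hz : 0 < z) (hr : 0 < r) (hθ : 0 ≤ θ)
    (hθ1 : θ ≤ 1) (h1 : profile z r ^ 2 ≤ K / r) (h2 : profile z r ^ 2 ≤ K * z) :
    profile z r ^ 2 ≤ K * z ^ θ * r ^ (θ - 1) := by
  have h0 : 0 ≤ profile z r ^ 2 := sq_nonneg _
  calc profile z r ^ 2 = (profile z r ^ 2) ^ θ * (profile z r ^ 2) ^ (1 - θ) := by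
        rw [← Real.rpow_add' h0 (by norm_num)]
        norm_num
    _ ≤ (K * z) ^ θ * (K / r) ^ (1 - θ) := by
        gcongr
    _ = K * z ^ θ * r ^ (θ - 1) := by
        rw [Real.mul_rpow hK.le hz.le, Real.div_rpow hK.le hr.le, ← neg_sub θ 1,
          Real.rpow_neg hr.le, div_inv_eq_mul, neg_sub]
        have : K ^ θ * K ^ (1 - θ) = K := by
          rw [← Real.rpow_add hK]
          norm_num
        calc _ = (K ^ θ * K ^ (1 - θ)) * z ^ θ * r ^ (θ - 1) := by ring
          _ = _ := by rw [this]

/-! ### The bilinear estimate for radial expansions -/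

theorem norm_expSum_sq_le {ι : Type} (S : Finset ι) (lam : ι → ℝ) (a : ι → ℂ) (t : ℝ) :
    ‖expSum S lam a t‖ ^ 2 ≤ S.card * ∑ i ∈ S, ‖a i‖ ^ 2 := by
  have h1 : ‖expSum S lam a t‖ ≤ ∑ i ∈ S, ‖a i‖ := by
    refine (norm_sum_le _ _).trans (Finset.sum_le_sum fun i _ => ?_)
    have : -(Complex.I * t * (lam i : ℂ)) = ((-(t * lam i) : ℝ) : ℂ) * Complex.I := by
      push_cast
      ring
    rw [norm_mul, this, Complex.norm_exp_ofReal_mul_I, mul_one]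
  calc ‖expSum S lam a t‖ ^ 2 ≤ (∑ i ∈ S, ‖a i‖) ^ 2 := by gcongr
    _ ≤ S.card * ∑ i ∈ S, ‖a i‖ ^ 2 := sq_sum_le_card_mul_sum_sq

theorem sum_norm_mul_sq_le {ι : Type} (S : Finset ι) (c : ι → ℂ) (y : ι → ℝ) {B : ℝ}
    (hy : ∀ i ∈ S, y i ^ 2 ≤ B) :
    ∑ i ∈ S, ‖c i * (y i : ℂ)‖ ^ 2 ≤ B * ∑ i ∈ S, ‖c i‖ ^ 2 := by
  rw [Finset.mul_sum]
  refine Finset.sum_le_sum fun i hi => ?_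
  rw [norm_mul, mul_pow, Complex.norm_real, Real.norm_eq_abs, sq_abs, mul_comm]
  exact mul_le_mul_of_nonneg_right (hy i hi) (sq_nonneg _)

theorem continuous_expSum_norm {ι : Type} (S : Finset ι) (lam : ι → ℝ) (c : ι → ℂ)
    (p : ι → ℝ → ℝ) (hp : ∀ i, Continuous (p i)) :
    Continuous fun w : ℝ × Plane => expSum S lam (fun i => c i * (p i ‖w.2‖ : ℂ)) w.1 := by
  unfold expSum
  fun_prop

theorem lintegral_lintegral_mul_weight {X Y : Type*} [MeasurableSpace X] [MeasurableSpace Y]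
    {μ : Measure X} {ν : Measure Y} [SFinite μ] [SFinite ν] {F : X × Y → ℝ≥0∞} {W : Y → ℝ≥0∞}
    (hF : Measurable F) (hW : Measurable W) :
    ∫⁻ t, ∫⁻ x, F (t, x) * W x ∂ν ∂μ = ∫⁻ x, (∫⁻ t, F (t, x) ∂μ) * W x ∂ν := by
  rw [lintegral_lintegral_swap (f := fun t x => F (t, x) * W x)
    (hF.mul (hW.comp measurable_snd)).aemeasurable]
  refine lintegral_congr fun x => ?_
  exact lintegral_mul_const (f := fun t => F (t, x)) _ (hF.comp measurable_prodMk_right)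

/-- The bilinear estimate for expansions in radial profiles. The second factor is bounded by
the Cauchy-Schwarz inequality uniformly in time; this bound is a weight in `x`, with respect to
which the large sieve inequality is applied to the first factor at each point `x`. -/
theorem lintegral_expSum_mul_expSum_le {C : ℝ} {ι : Type} (S T : Finset ι) (lam : ι → ℝ)
    (hC : ∀ a : ι → ℂ, ∫⁻ t in Ioo (0 : ℝ) 1, ‖expSum S lam a t‖ₑ ^ 2 ≤
        ENNReal.ofReal (C * ∑ i ∈ S, ‖a i‖ ^ 2)) (hC0 : 0 < C)
    (c d : ι → ℂ) (p q : ι → ℝ → ℝ) (hp : ∀ i, Continuous (p i))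
    {K L θ : ℝ} (hK : 0 < K) (hL : 0 < L) (hθ : 0 < θ)
    (hpK : ∀ i ∈ S, ∀ r : ℝ, 0 < r → p i r ^ 2 ≤ K / r)
    (hqL : ∀ i ∈ T, ∀ r : ℝ, 0 < r → q i r ^ 2 ≤ L * r ^ (θ - 1)) :
    ∫⁻ t in Ioo (0 : ℝ) 1, ∫⁻ x in disk,
        ‖expSum S lam (fun i => c i * (p i ‖x‖ : ℂ)) t‖ₑ ^ 2 *
          ‖expSum T lam (fun i => d i * (q i ‖x‖ : ℂ)) t‖ₑ ^ 2 ≤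
      ENNReal.ofReal (C * K * L * (circleLength / θ) * T.card * (∑ i ∈ S, ‖c i‖ ^ 2) *
        ∑ i ∈ T, ‖d i‖ ^ 2) := by
  set A := ∑ i ∈ S, ‖c i‖ ^ 2
  set D := ∑ i ∈ T, ‖d i‖ ^ 2
  have hA : 0 ≤ A := Finset.sum_nonneg fun i _ => sq_nonneg _
  have hD : 0 ≤ D := Finset.sum_nonneg fun i _ => sq_nonneg _
  have hne : ∀ᵐ x : Plane ∂(volume.restrict disk), x ≠ 0 :=
    ae_restrict_of_ae (Measure.ae_ne volume 0)
  have hm := (continuous_expSum_norm S lam c p hp).enorm.measurable.pow_const 2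
  have hw : Measurable fun x : Plane =>
      ENNReal.ofReal (T.card * (L * ‖x‖ ^ (θ - 1) * D)) := by fun_prop
  calc ∫⁻ t in Ioo (0 : ℝ) 1, ∫⁻ x in disk,
        ‖expSum S lam (fun i => c i * (p i ‖x‖ : ℂ)) t‖ₑ ^ 2 *
          ‖expSum T lam (fun i => d i * (q i ‖x‖ : ℂ)) t‖ₑ ^ 2
      ≤ ∫⁻ t in Ioo (0 : ℝ) 1, ∫⁻ x in disk,
        ‖expSum S lam (fun i => c i * (p i ‖x‖ : ℂ)) t‖ₑ ^ 2 *
          ENNReal.ofReal (T.card * (L * ‖x‖ ^ (θ - 1) * D)) := by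
        refine lintegral_mono fun t => lintegral_mono_ae ?_
        filter_upwards [hne] with x hx
        gcongr
        rw [← ofReal_norm, ← ENNReal.ofReal_pow (norm_nonneg _)]
        refine ENNReal.ofReal_le_ofReal ((norm_expSum_sq_le _ _ _ _).trans ?_)
        gcongr
        exact sum_norm_mul_sq_le T d _ fun i hi => hqL i hi _ (norm_pos_iff.mpr hx)
    _ = ∫⁻ x in disk, (∫⁻ t in Ioo (0 : ℝ) 1,
        ‖expSum S lam (fun i => c i * (p i ‖x‖ : ℂ)) t‖ₑ ^ 2) *
          ENNReal.ofReal (T.card * (L * ‖x‖ ^ (θ - 1) * D)) :=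
        lintegral_lintegral_mul_weight hm hw
    _ ≤ ∫⁻ x in disk, ENNReal.ofReal (C * K * L * T.card * A * D) *
          ENNReal.ofReal (‖x‖ ^ (θ - 2)) := by
        refine lintegral_mono_ae ?_
        filter_upwards [hne] with x hx
        have hx0 : 0 < ‖x‖ := norm_pos_iff.mpr hx
        have hs : ∫⁻ t in Ioo (0 : ℝ) 1, ‖expSum S lam (fun i => c i * (p i ‖x‖ : ℂ)) t‖ₑ ^ 2 ≤
            ENNReal.ofReal (C * (K / ‖x‖ * A)) := by
          refine (hC _).trans (ENNReal.ofReal_le_ofReal ?_)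
          gcongr
          exact sum_norm_mul_sq_le S c (fun i => p i ‖x‖) fun i hi => hpK i hi _ hx0
        refine (mul_le_mul_left hs _).trans_eq ?_
        rw [← ENNReal.ofReal_mul (by positivity), ← ENNReal.ofReal_mul (by positivity)]
        congr 1
        have hpow : ‖x‖ ^ (θ - 2) = ‖x‖ ^ (θ - 1) / ‖x‖ := by
          rw [← Real.rpow_sub_one hx0.ne']
          ring_nf
        rw [hpow]
        ring
    _ = ENNReal.ofReal (C * K * L * (circleLength / θ) * T.card * A * D) := by
        rw [lintegral_const_mul' _ _ ENNReal.ofReal_ne_top, lintegral_disk_norm_rpow hθ,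
          ← ENNReal.ofReal_mul (by positivity)]
        congr 1
        ring

/-! ### Expansion of the flow -/

theorem exists_besselZeros_count :
    ∃ C : ℝ, 0 < C ∧ ∀ N : ℝ, 0 < N → {z : besselZeros | (z : ℝ) ∈ Icc N (2 * N)}.Finite ∧
      ∀ S : Finset besselZeros, (∀ z ∈ S, (z : ℝ) ∈ Icc N (2 * N)) → S.card ≤ C * N := by
  obtain ⟨δ, hδ, hgap⟩ := exists_besselZeros_gap
  have hmaps : ∀ N : ℝ, ∀ z : ℝ, z ∈ Icc N (2 * N) →
      ⌊(z - N) / δ⌋₊ ∈ Finset.range (⌊N / δ⌋₊ + 1) := by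
    intro N z hz
    rw [Finset.mem_range, Nat.lt_succ_iff]
    refine Nat.floor_le_floor ?_
    gcongr
    linarith [hz.2]
  have hinj : ∀ N : ℝ, Set.InjOn (fun z : besselZeros => ⌊((z : ℝ) - N) / δ⌋₊)
      {z : besselZeros | (z : ℝ) ∈ Icc N (2 * N)} := by
    intro N
    have hlt : ∀ z z' : besselZeros, (z : ℝ) ∈ Icc N (2 * N) → (z : ℝ) < z' →
        ⌊((z : ℝ) - N) / δ⌋₊ < ⌊((z' : ℝ) - N) / δ⌋₊ := by
      intro z z' hz hlt
      have h0 : 0 ≤ ((z : ℝ) - N) / δ := div_nonneg (by linarith [hz.1]) hδ.le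
      have h1 := hgap z z.2 z' z'.2 hlt
      rw [← Nat.succ_le_iff, Nat.succ_eq_add_one, ← Nat.floor_add_one h0]
      refine Nat.floor_le_floor ?_
      rw [div_add_one hδ.ne']
      gcongr
      linarith
    intro z hz z' hz' heq
    rcases lt_trichotomy (z : ℝ) z' with h | h | h
    · exact absurd heq (hlt z z' hz h).ne
    · exact Subtype.ext h
    · exact absurd heq (hlt z' z hz' h).ne'
  refine ⟨1 / δ + 2, by positivity, fun N hN => ⟨?_, fun S hS => ?_⟩⟩
  · exact Set.Finite.of_injOn (fun z hz => hmaps N z hz) (hinj N)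
      (Finset.finite_toSet (Finset.range (⌊N / δ⌋₊ + 1)))
  · rcases S.eq_empty_or_nonempty with rfl | ⟨z, hz⟩
    · simp only [Finset.card_empty, Nat.cast_zero]
      positivity
    · have hcard : S.card ≤ ⌊N / δ⌋₊ + 1 := by
        have h := Finset.card_le_card_of_injOn (t := Finset.range (⌊N / δ⌋₊ + 1))
          (fun z : besselZeros => ⌊((z : ℝ) - N) / δ⌋₊)
          (fun z hz => hmaps N z (hS z hz)) ((hinj N).mono fun z hz => hS z hz)
        rwa [Finset.card_range] at h
      have h1 : (S.card : ℝ) ≤ N / δ + 1 := by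
        calc (S.card : ℝ) ≤ (⌊N / δ⌋₊ : ℝ) + 1 := by exact_mod_cast hcard
          _ ≤ N / δ + 1 := by
            gcongr
            exact Nat.floor_le (by positivity)
      have h2 := (hS z hz).2
      have h3 := one_lt_of_mem_besselZeros z.2
      have h4 : (1 / δ + 2) * N = N / δ + 2 * N := by ring
      rw [h4]
      linarith

/-- A function in the range of the spectral projection is a finite combination of
eigenfunctions, on which the flow acts by multiplying the coefficients. -/
theorem exists_flow_eq_sum {N : ℝ} (hN : 0 < N) {u : L2} (hu : spectralProjection N u = u) :
    ∃ S : Finset besselZeros, (∀ z ∈ S, (z : ℝ) ∈ Icc N (2 * N)) ∧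
      ∀ α t : ℝ, flow α t u = ∑ z ∈ S,
        (Complex.exp (-(Complex.I * t * (((z : ℝ) ^ (2 * α) : ℝ) : ℂ))) *
          inner ℂ (eigenfun z) u) • eigenfun z := by
  obtain ⟨_, _, hcount⟩ := exists_besselZeros_count
  have hfin := (hcount N hN).1
  have hmem : ∀ z : besselZeros, z ∈ hfin.toFinset ↔ (z : ℝ) ∈ Icc N (2 * N) := fun z => by simp
  refine ⟨hfin.toFinset, fun z hz => (hmem z).mp hz, fun α t => ?_⟩
  have hexp : u = ∑ z ∈ hfin.toFinset, inner ℂ (eigenfun z) u • eigenfun z := by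
    conv_lhs => rw [← hu, spectralProjection, spectralMultiplier]
    rw [tsum_eq_sum (s := hfin.toFinset)]
    · refine Finset.sum_congr rfl fun z hz => ?_
      rw [indicator_of_mem ((hmem z).mp hz), one_mul]
    · intro z hz
      rw [indicator_of_notMem (fun h => hz ((hmem z).mpr h)), zero_mul, zero_smul]
  rw [flow, spectralMultiplier]
  refine tsum_eq_sum fun w hw => ?_
  have h0 : inner ℂ (eigenfun w) u = 0 := by
    rw [hexp, inner_sum]
    refine Finset.sum_eq_zero fun z hz => ?_
    have hne : w ≠ z := fun h => hw (h ▸ hz)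
    have := orthonormal_eigenfun.2 hne
    rw [inner_smul_right, this, mul_zero]
  rw [h0, mul_zero, zero_smul]

theorem flow_ae_eq_expSum {u : L2} {S : Finset besselZeros} {α t : ℝ}
    (h : flow α t u = ∑ z ∈ S,
        (Complex.exp (-(Complex.I * t * (((z : ℝ) ^ (2 * α) : ℝ) : ℂ))) *
          inner ℂ (eigenfun z) u) • eigenfun z) :
    flow α t u =ᵐ[diskMeasure] fun x => expSum S (fun z => (z : ℝ) ^ (2 * α))
      (fun z => inner ℂ (eigenfun z) u * (profile z ‖x‖ : ℂ)) t := by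
  rw [h]
  have h1 : ∀ᵐ x ∂diskMeasure, ∀ z ∈ S,
      ((Complex.exp (-(Complex.I * t * (((z : ℝ) ^ (2 * α) : ℝ) : ℂ))) *
          inner ℂ (eigenfun z) u) • eigenfun z : L2) x =
        Complex.exp (-(Complex.I * t * (((z : ℝ) ^ (2 * α) : ℝ) : ℂ))) *
          inner ℂ (eigenfun z) u * (profile z ‖x‖ : ℂ) := by
    rw [Finset.eventually_all]
    intro z _
    filter_upwards [Lp.coeFn_smul (Complex.exp (-(Complex.I * t * (((z : ℝ) ^ (2 * α) : ℝ) : ℂ))) *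
          inner ℂ (eigenfun z) u) (eigenfun z), eigenfun_ae_eq z] with x hx hx2
    rw [hx, Pi.smul_apply, hx2, smul_eq_mul]
  filter_upwards [h1, Lp.coeFn_finsetSum S fun z : besselZeros =>
    ((Complex.exp (-(Complex.I * t * (((z : ℝ) ^ (2 * α) : ℝ) : ℂ))) *
          inner ℂ (eigenfun z) u) • eigenfun z : L2)] with x hx hs
  rw [hs, Finset.sum_apply, expSum]
  refine Finset.sum_congr rfl fun z hz => ?_
  rw [hx z hz]
  ring

theorem sum_norm_inner_eigenfun_sq_le (S : Finset besselZeros) (u : L2) :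
    ∑ z ∈ S, ‖(inner ℂ (eigenfun z) u : ℂ)‖ ^ 2 ≤ ‖u‖ ^ 2 :=
  orthonormal_eigenfun.sum_inner_products_le u

/-! ### Weak gradients -/

/-- The factor `k` in `∇ (profile z ‖x‖) = -k(‖x‖) x`; continuous up to the origin. -/
def gradFactor (z r : ℝ) : ℝ := ‖besselModeL2 z‖⁻¹ * (z ^ 2 * besselK (z * r))

theorem continuous_gradFactor (z : ℝ) : Continuous (gradFactor z) :=
  continuous_const.mul (continuous_const.mul
    (continuous_besselK.comp (continuous_const.mul continuous_id)))

theorem gradFactor_mul (z r : ℝ) : gradFactor z r * r = z * gradProfile z r := by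
  rw [gradFactor, gradProfile, besselJ1_eq_mul]
  ring

theorem hasDerivAt_profile (z r : ℝ) : HasDerivAt (profile z) (-(gradFactor z r * r)) r := by
  have h := ((hasDerivAt_besselJ0 (z * r)).comp r ((hasDerivAt_id r).const_mul z)).const_mul
    ‖besselModeL2 z‖⁻¹
  refine h.congr_deriv ?_
  rw [gradFactor_mul, gradProfile]
  ring

theorem hasFDerivAt_profile_norm (z : ℝ) (x : Plane) :
    HasFDerivAt (fun x : Plane => profile z ‖x‖) (-(gradFactor z ‖x‖) • innerSL ℝ x) x := by
  rcases eq_or_ne x 0 with rfl | hx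
  · -- The norm is not differentiable at the origin, but the derivative of the profile vanishes.
    have h := hasDerivAt_profile z 0
    rw [mul_zero, neg_zero] at h
    rw [hasDerivAt_iff_isLittleO_nhds_zero] at h
    have h2 := h.comp_tendsto (k := fun y : Plane => ‖y‖) (l' := nhds 0)
      (by simpa using (continuous_norm (E := Plane)).tendsto 0)
    rw [hasFDerivAt_iff_isLittleO_nhds_zero]
    refine (Asymptotics.IsLittleO.of_norm_right
      (h2.congr (fun y => ?_) fun y => ?_))
    · simp
    · rfl
  · have h1 : HasFDerivAt (fun x : Plane => ‖x‖) (‖x‖⁻¹ • innerSL ℝ x) x := by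
      have h := (hasStrictFDerivAt_norm_sq x).hasFDerivAt.sqrt (by simpa using hx)
      refine (h.congr_fderiv ?_).congr_of_eventuallyEq (.of_forall fun y => ?_)
      · rw [Real.sqrt_sq (norm_nonneg _)]
        ext v
        simp
        ring
      · exact (Real.sqrt_sq (norm_nonneg _)).symm
    have h := (hasDerivAt_profile z ‖x‖).comp_hasFDerivAt x h1
    refine h.congr_fderiv ?_
    rw [smul_smul]
    congr 1
    have := norm_ne_zero_iff.mpr hx
    field_simp

/-- The gradient of `x ↦ expSum S lam (fun z => c z * profile z ‖x‖) t`. -/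
def expSumGrad (S : Finset besselZeros) (lam : besselZeros → ℝ) (c : besselZeros → ℂ) (t : ℝ)
    (x : Plane) : EuclideanSpace ℂ (Fin 2) :=
  WithLp.toLp 2 fun i => -(expSum S lam (fun z => c z * (gradFactor z ‖x‖ : ℂ)) t * (x i : ℂ))

theorem continuous_expSumGrad (S : Finset besselZeros) (lam : besselZeros → ℝ)
    (c : besselZeros → ℂ) (t : ℝ) : Continuous (expSumGrad S lam c t) := by
  have h := (continuous_expSum_norm S lam c (fun z => gradFactor z)
    fun z => continuous_gradFactor z).comp (continuous_const (y := t) |>.prodMk continuous_id)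
  refine (PiLp.continuous_toLp 2 _).comp (continuous_pi fun i => ?_)
  refine (h.mul ?_).neg
  fun_prop

theorem norm_expSumGrad (S : Finset besselZeros) (lam : besselZeros → ℝ)
    (c : besselZeros → ℂ) (t : ℝ) (x : Plane) :
    ‖expSumGrad S lam c t x‖ =
      ‖expSum S lam (fun z => c z * ((z * gradProfile z ‖x‖ : ℝ) : ℂ)) t‖ := by
  have h1 : expSum S lam (fun z => c z * ((z * gradProfile z ‖x‖ : ℝ) : ℂ)) t =
      expSum S lam (fun z => c z * (gradFactor z ‖x‖ : ℂ)) t * (‖x‖ : ℂ) := by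
    rw [expSum, expSum, Finset.sum_mul]
    refine Finset.sum_congr rfl fun z _ => ?_
    rw [← gradFactor_mul]
    push_cast
    ring
  rw [h1, norm_mul, Complex.norm_real, norm_norm, EuclideanSpace.norm_eq]
  simp only [expSumGrad, norm_neg, norm_mul, mul_pow, Complex.norm_real]
  rw [← Finset.mul_sum, Real.sqrt_mul (sq_nonneg _), Real.sqrt_sq (norm_nonneg _),
    ← EuclideanSpace.norm_eq]

theorem hasLineDerivAt_expSum_profile (S : Finset besselZeros) (lam : besselZeros → ℝ)
    (c : besselZeros → ℂ) (t : ℝ) (x : Plane) (i : Fin 2) :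
    HasLineDerivAt ℝ (fun x : Plane => expSum S lam (fun z => c z * (profile z ‖x‖ : ℂ)) t)
      (expSumGrad S lam c t x i) x (EuclideanSpace.single i 1) := by
  have h : ∀ z ∈ S, HasDerivAt (fun s : ℝ =>
      c z * (profile z ‖x + s • EuclideanSpace.single i (1 : ℝ)‖ : ℂ) *
        Complex.exp (-(Complex.I * t * (lam z : ℂ))))
      (c z * ((-(gradFactor z ‖x‖ * x i) : ℝ) : ℂ) *
        Complex.exp (-(Complex.I * t * (lam z : ℂ)))) 0 := by
    intro z _
    have h1 : HasDerivAt (fun s : ℝ => profile z ‖x + s • EuclideanSpace.single i (1 : ℝ)‖)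
        (-(gradFactor z ‖x‖ * x i)) 0 :=
      HasDerivAt.congr_deriv ((hasFDerivAt_profile_norm z x).hasLineDerivAt
        (EuclideanSpace.single i 1)) (by simp [EuclideanSpace.inner_single_right])
    exact (h1.ofReal_comp.const_mul _).mul_const _
  refine HasDerivAt.congr_deriv (HasDerivAt.fun_sum h) ?_
  simp only [expSumGrad, expSum]
  rw [Finset.sum_mul, ← Finset.sum_neg_distrib]
  refine Finset.sum_congr rfl fun z _ => ?_
  push_cast
  ring

/-- A continuous function with continuous partial derivatives has these as its weak gradient. -/
theorem isWeakGradient_of_hasLineDerivAt {f : L2} {F : Plane → ℂ}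
    {G : Plane → EuclideanSpace ℂ (Fin 2)} (hf : f =ᵐ[diskMeasure] F) (hF : Continuous F)
    (hG : Continuous G)
    (hd : ∀ x i, HasLineDerivAt ℝ F (G x i) x (EuclideanSpace.single i 1)) :
    IsWeakGradient f G := by
  refine ⟨hG.locallyIntegrable.locallyIntegrableOn _, fun φ hφ hφc hφs i => ?_⟩
  set v : Plane := EuclideanSpace.single i 1
  have hGi : Continuous fun x => G x i := by fun_prop
  have hφ' : Continuous fun x => fderiv ℝ φ x v :=
    (hφ.continuous_fderiv (by simp)).clm_apply continuous_const
  have hφ'c : HasCompactSupport fun x => fderiv ℝ φ x v := hφc.fderiv_apply ℝ v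
  have hcs : ∀ {g : Plane → ℝ}, HasCompactSupport g → HasCompactSupport fun x => ((g x : ℝ) : ℂ) :=
    fun h => h.comp_left Complex.ofReal_zero
  have key := integral_bilinear_hasLineDerivAt_right_eq_neg_left_of_integrable (μ := volume)
    (f := F) (f' := fun x => G x i) (g := fun x => ((φ x : ℝ) : ℂ))
    (g' := fun x => ((fderiv ℝ φ x v : ℝ) : ℂ)) (v := v) (B := ContinuousLinearMap.mul ℝ ℂ)
    ((hGi.mul (Complex.continuous_ofReal.comp hφ.continuous)).integrable_of_hasCompactSupport
      (hcs hφc).mul_left)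
    ((hF.mul (Complex.continuous_ofReal.comp hφ')).integrable_of_hasCompactSupport
      (hcs hφ'c).mul_left)
    ((hF.mul (Complex.continuous_ofReal.comp hφ.continuous)).integrable_of_hasCompactSupport
      (hcs hφc).mul_left)
    (fun x _ => hd x i)
    (fun x _ => HasDerivAt.ofReal_comp
      ((hφ.differentiable (by simp) x).hasFDerivAt.hasLineDerivAt v))
  simp only [ContinuousLinearMap.mul_apply'] at key
  have hφ0 : ∀ x, x ∉ disk → φ x = 0 := fun x hx =>
    image_eq_zero_of_notMem_tsupport fun h => hx (hφs h)
  have hφ'0 : ∀ x, x ∉ disk → fderiv ℝ φ x v = 0 := fun x hx => by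
    rw [fderiv_of_notMem_tsupport (𝕜 := ℝ) fun h => hx (hφs h)]
    rfl
  have h1 : ∫ x in disk, f x * ((fderiv ℝ φ x v : ℝ) : ℂ) =
      ∫ x in disk, F x * ((fderiv ℝ φ x v : ℝ) : ℂ) := by
    refine integral_congr_ae ?_
    filter_upwards [hf] with x hx
    rw [hx]
  rw [h1, setIntegral_eq_integral_of_forall_compl_eq_zero fun x hx => by simp [hφ'0 x hx],
    setIntegral_eq_integral_of_forall_compl_eq_zero fun x hx => by simp [hφ0 x hx]]
  exact key

theorem isWeakGradient_expSumGrad {f : L2} (S : Finset besselZeros) (lam : besselZeros → ℝ)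
    (c : besselZeros → ℂ) (t : ℝ)
    (hf : f =ᵐ[diskMeasure] fun x => expSum S lam (fun z => c z * (profile z ‖x‖ : ℂ)) t) :
    IsWeakGradient f (expSumGrad S lam c t) := by
  have hprof : ∀ z : besselZeros, Continuous fun x : Plane => profile z ‖x‖ := fun z =>
    (continuous_profile z).comp continuous_norm
  have hc : Continuous fun x : Plane =>
      expSum S lam (fun z => c z * (profile z ‖x‖ : ℂ)) t := by
    unfold expSum
    fun_prop
  exact isWeakGradient_of_hasLineDerivAt hf hc (continuous_expSumGrad S lam c t)
    fun x i => hasLineDerivAt_expSum_profile S lam c t x i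

theorem IsWeakGradient.ae_eq {f : L2} {G H : Plane → EuclideanSpace ℂ (Fin 2)}
    (hG : IsWeakGradient f G) (hH : IsWeakGradient f H) : G =ᵐ[diskMeasure] H := by
  have hopen : IsOpen disk := Metric.isOpen_ball
  have h := hopen.ae_eq_zero_of_integral_contDiff_smul_eq_zero (hG.1.sub hH.1)
    fun φ hφ hφc hφs => by
      have hint : ∀ {G : Plane → EuclideanSpace ℂ (Fin 2)}, LocallyIntegrableOn G disk →
          IntegrableOn (fun x => φ x • G x) disk := by
        intro G hG
        have h1 : IntegrableOn (fun x => φ x • G x) (tsupport φ) :=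
          (hG.integrableOn_compact_subset hφs hφc).continuousOn_smul
            hφ.continuous.continuousOn hφc
        have h2 : Integrable fun x => φ x • G x := by
          rw [← integrableOn_iff_integrable_of_support_subset (s := tsupport φ)]
          · exact h1
          · exact (Function.support_smul_subset_left φ G).trans (subset_tsupport φ)
        exact h2.integrableOn
      have hcoord : ∀ {G : Plane → EuclideanSpace ℂ (Fin 2)}, LocallyIntegrableOn G disk →
          ∀ i, (∫ x in disk, φ x • G x) i = ∫ x in disk, G x i * ((φ x : ℝ) : ℂ) := by
        intro G hG i
        have h1 := (EuclideanSpace.proj (𝕜 := ℂ) i).integral_comp_comm (hint hG)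
        refine h1.symm.trans (integral_congr_ae (.of_forall fun x => ?_))
        simp [mul_comm]
      have hout : ∀ x, x ∉ disk → φ x • (G - H) x = 0 := fun x hx => by
        rw [image_eq_zero_of_notMem_tsupport fun h => hx (hφs h), zero_smul]
      rw [← setIntegral_eq_integral_of_forall_compl_eq_zero hout]
      simp only [Pi.sub_apply, smul_sub]
      rw [integral_sub (hint hG.1) (hint hH.1), sub_eq_zero]
      ext i
      rw [hcoord hG.1, hcoord hH.1]
      exact neg_injective ((hG.2 φ hφ hφc hφs i).symm.trans (hH.2 φ hφ hφc hφs i))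
  rw [diskMeasure, Filter.EventuallyEq, ae_restrict_iff' hopen.measurableSet]
  filter_upwards [h] with x hx hxd
  exact sub_eq_zero.mp (hx hxd)

/-! ### Frequencies and the bilinear estimate for the flow -/

/-- Since `2α ≥ 1`, the map `z ↦ z ^ (2α)` does not shrink distances on `[1, ∞)`. -/
theorem sub_le_rpow_sub_rpow {p x y : ℝ} (hp : 1 ≤ p) (hx : 1 ≤ x) (hxy : x ≤ y) :
    y - x ≤ y ^ p - x ^ p := by
  have hx0 : 0 < x := by linarith
  have hy0 : 0 < y := by linarith
  have h1 : x ^ (p - 1) ≤ y ^ (p - 1) := Real.rpow_le_rpow hx0.le hxy (by linarith)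
  have h2 : 1 ≤ x ^ (p - 1) := Real.one_le_rpow hx (by linarith)
  have hx' : x ^ p = x * x ^ (p - 1) := by
    rw [Real.rpow_sub_one hx0.ne']
    field_simp
  have hy' : y ^ p = y * y ^ (p - 1) := by
    rw [Real.rpow_sub_one hy0.ne']
    field_simp
  rw [hx', hy']
  nlinarith [mul_le_mul_of_nonneg_left h1 hy0.le]

theorem exists_frequency_gap :
    ∃ δ : ℝ, 0 < δ ∧ ∀ α : ℝ, 1 / 2 ≤ α → ∀ z z' : besselZeros, z ≠ z' →
      δ ≤ |(z : ℝ) ^ (2 * α) - (z' : ℝ) ^ (2 * α)| := by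
  obtain ⟨δ, hδ, hgap⟩ := exists_besselZeros_gap
  refine ⟨δ, hδ, fun α hα => ?_⟩
  have key : ∀ z z' : besselZeros, (z : ℝ) < z' →
      δ ≤ (z' : ℝ) ^ (2 * α) - (z : ℝ) ^ (2 * α) := fun z z' h =>
    (hgap z z.2 z' z'.2 h).trans (sub_le_rpow_sub_rpow (by linarith)
      (one_lt_of_mem_besselZeros z.2).le h.le)
  intro z z' hne
  rcases lt_trichotomy (z : ℝ) z' with h | h | h
  · rw [abs_sub_comm]
    exact (key z z' h).trans (le_abs_self _)
  · exact absurd (Subtype.ext h) hne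
  · exact (key z' z h).trans (le_abs_self _)

/-- The number of zeros in `[N, 2N]`, times the factor `(2N) ^ θ` lost in the interpolation of the
profiles, is at most a multiple of `N ^ (1 + 2ε)`. -/
theorem exists_card_mul_rpow_le {ε θ : ℝ} (hε : 0 < ε) (hθ : θ ≤ 2 * ε) :
    ∃ C : ℝ, 0 < C ∧ ∀ N : ℝ, 0 < N → ∀ T : Finset besselZeros,
      (∀ z ∈ T, (z : ℝ) ∈ Icc N (2 * N)) →
      T.card * (2 * N) ^ θ ≤ C * (N ^ (1 / 2 + ε)) ^ 2 := by
  obtain ⟨C, hC, hcount⟩ := exists_besselZeros_count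
  refine ⟨C * 2 ^ (2 * ε), by positivity, fun N hN T hT => ?_⟩
  rcases T.eq_empty_or_nonempty with rfl | ⟨z, hz⟩
  · simp only [Finset.card_empty, Nat.cast_zero, zero_mul]
    positivity
  · -- As the zeros exceed `1`, a nonempty `T` forces `1 ≤ 2 * N`, and `θ` may be raised to `2ε`.
    have h1 : 1 ≤ 2 * N := by linarith [one_lt_of_mem_besselZeros z.2, (hT z hz).2]
    have h2 : (N ^ (1 / 2 + ε)) ^ 2 = N * N ^ (2 * ε) := by
      rw [← Real.rpow_natCast, ← Real.rpow_mul hN.le, ← Real.rpow_one_add' hN.le]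
      · congr 1
        push_cast
        ring
      · positivity
    calc (T.card : ℝ) * (2 * N) ^ θ ≤ (C * N) * (2 * N) ^ (2 * ε) := by
          gcongr
          exact (hcount N hN).2 T hT
      _ = C * 2 ^ (2 * ε) * (N ^ (1 / 2 + ε)) ^ 2 := by
          rw [h2, Real.mul_rpow two_pos.le hN.le]
          ring

/-- The bilinear estimate for finite expansions. The profiles `p` of the first factor are either
those of the eigenfunctions or those of their gradients, with size `A`. -/
theorem exists_bilinear_le {α ε : ℝ} (hα : 1 / 2 ≤ α) (hε : 0 < ε) :
    ∃ M : ℝ, 0 < M ∧ ∀ A N₂ : ℝ, 0 < A → 0 < N₂ → ∀ S T : Finset besselZeros,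
      (∀ z ∈ T, (z : ℝ) ∈ Icc N₂ (2 * N₂)) →
      ∀ p : besselZeros → ℝ → ℝ, (∀ z, Continuous (p z)) →
      (∀ z ∈ S, ∀ r : ℝ, 0 < r → (|p z r| ≤ A * |profile z r| ∨ |p z r| ≤ A * |gradProfile z r|)) →
      ∀ u₁ u₂ : L2,
        ∫⁻ t in Ioo (0 : ℝ) 1, ∫⁻ x in disk,
          ‖expSum S (fun z => (z : ℝ) ^ (2 * α))
            (fun z => inner ℂ (eigenfun z) u₁ * (p z ‖x‖ : ℂ)) t‖ₑ ^ 2 *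
          ‖expSum T (fun z => (z : ℝ) ^ (2 * α))
            (fun z => inner ℂ (eigenfun z) u₂ * (profile z ‖x‖ : ℂ)) t‖ₑ ^ 2 ≤
        ENNReal.ofReal ((M * A * N₂ ^ (1 / 2 + ε) * ‖u₁‖ * ‖u₂‖) ^ 2) := by
  -- The weight `r ^ (θ - 2)` is integrable on the disk for `θ > 0`, and interpolation of the
  -- profile bounds needs `θ ≤ 1`.
  set θ := min (2 * ε) 1
  have hθ0 : 0 < θ := by positivity
  obtain ⟨δ, hδ, hgap⟩ := exists_frequency_gap
  obtain ⟨C, hC, hsieve⟩ := exists_lintegral_expSum_sq_le hδ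
  obtain ⟨K, hK, hprof⟩ := exists_profile_bounds
  obtain ⟨B, hB, hcard⟩ := exists_card_mul_rpow_le hε (min_le_left (2 * ε) 1)
  have hκ := circleLength_pos
  refine ⟨√(C * K * K * (circleLength / θ) * B), by positivity,
    fun A N₂ hA hN₂ S T hT p hpc hp u₁ u₂ => ?_⟩
  have hpK : ∀ z ∈ S, ∀ r : ℝ, 0 < r → p z r ^ 2 ≤ A ^ 2 * K / r := by
    intro z hz r hr
    obtain ⟨h1, h2, -⟩ := hprof z z.2 r hr
    have hA2 : A ^ 2 * K / r = A ^ 2 * (K / r) := by ring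
    have key : ∀ y : ℝ, |p z r| ≤ A * |y| → y ^ 2 ≤ K / r → p z r ^ 2 ≤ A ^ 2 * (K / r) := by
      intro y hy hyK
      calc p z r ^ 2 = |p z r| ^ 2 := (sq_abs _).symm
        _ ≤ (A * |y|) ^ 2 := by gcongr
        _ = A ^ 2 * y ^ 2 := by rw [mul_pow, sq_abs]
        _ ≤ A ^ 2 * (K / r) := by gcongr
    rw [hA2]
    exact (hp z hz r hr).elim (fun h => key _ h h1) fun h => key _ h h2
  have hqL : ∀ z ∈ T, ∀ r : ℝ, 0 < r →
      profile z r ^ 2 ≤ K * (2 * N₂) ^ θ * r ^ (θ - 1) := by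
    intro z hz r hr
    obtain ⟨h1, -, h3⟩ := hprof z z.2 r hr
    have hz0 : (0 : ℝ) < z := z.2.1
    refine (profile_sq_le_rpow hK hz0 hr hθ0.le (min_le_right _ _) h1 h3).trans ?_
    gcongr
    exact (hT z hz).2
  refine (lintegral_expSum_mul_expSum_le S T _
    (hsieve besselZeros S _ fun i _ j _ hij => hgap α hα i j hij) hC _ _ p
    (fun z => profile z) hpc (by positivity) (by positivity) hθ0 hpK hqL).trans
    (ENNReal.ofReal_le_ofReal ?_)
  have h1 := sum_norm_inner_eigenfun_sq_le S u₁
  have h2 := sum_norm_inner_eigenfun_sq_le T u₂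
  calc C * (A ^ 2 * K) * (K * (2 * N₂) ^ θ) * (circleLength / θ) * T.card *
        (∑ z ∈ S, ‖(inner ℂ (eigenfun z) u₁ : ℂ)‖ ^ 2) *
          ∑ z ∈ T, ‖(inner ℂ (eigenfun z) u₂ : ℂ)‖ ^ 2
      ≤ C * (A ^ 2 * K) * (K * (2 * N₂) ^ θ) * (circleLength / θ) * T.card *
        ‖u₁‖ ^ 2 * ‖u₂‖ ^ 2 := by gcongr
    _ = C * K * K * (circleLength / θ) * A ^ 2 * ‖u₁‖ ^ 2 * ‖u₂‖ ^ 2 *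
        (T.card * (2 * N₂) ^ θ) := by ring
    _ ≤ C * K * K * (circleLength / θ) * A ^ 2 * ‖u₁‖ ^ 2 * ‖u₂‖ ^ 2 *
        (B * (N₂ ^ (1 / 2 + ε)) ^ 2) :=
        mul_le_mul_of_nonneg_left (hcard N₂ hN₂ T hT) (by positivity)
    _ = (√(C * K * K * (circleLength / θ) * B) * A * N₂ ^ (1 / 2 + ε) * ‖u₁‖ * ‖u₂‖) ^ 2 := by
        simp only [mul_pow]
        rw [Real.sq_sqrt (by positivity)]
        ring

/-- A spacetime norm computed from factors that agree almost everywhere at each time. -/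
theorem spaceTimeNorm_le_of_lintegral_le {F : Type*} [NormedAddCommGroup F]
    {v : ℝ → Plane → F} {f g : ℝ → Plane → ℂ} {b : ℝ} (hb : 0 ≤ b)
    (hv : ∀ t, ∀ᵐ x ∂diskMeasure, ‖v t x‖ = ‖f t x‖ * ‖g t x‖)
    (h : ∫⁻ t in Ioo (0 : ℝ) 1, ∫⁻ x in disk, ‖f t x‖ₑ ^ 2 * ‖g t x‖ₑ ^ 2 ≤
      ENNReal.ofReal (b ^ 2)) :
    spaceTimeNorm v ≤ ENNReal.ofReal b := by
  have heq : ∫⁻ t in Ioo (0 : ℝ) 1, ∫⁻ x in disk, ‖v t x‖ₑ ^ 2 =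
      ∫⁻ t in Ioo (0 : ℝ) 1, ∫⁻ x in disk, ‖f t x‖ₑ ^ 2 * ‖g t x‖ₑ ^ 2 := by
    refine lintegral_congr fun t => lintegral_congr_ae ?_
    filter_upwards [hv t] with x hx
    rw [← mul_pow, ← ofReal_norm (v t x), hx, ENNReal.ofReal_mul (norm_nonneg _), ofReal_norm,
      ofReal_norm]
  rw [spaceTimeNorm, heq]
  calc _ ≤ ENNReal.ofReal (b ^ 2) ^ (1 / 2 : ℝ) := by gcongr
    _ = ENNReal.ofReal b := by
      rw [ENNReal.ofReal_rpow_of_nonneg (by positivity) (by norm_num), ← Real.sqrt_eq_rpow,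
        Real.sqrt_sq hb]

end RadialDisk

end

theorem lemma3p1 (α : ℝ) (hα : α ∈ Set.Ico (1 / 2 : ℝ) 1) (ε : ℝ) (hε : 0 < ε) :
    ∃ C : ℝ, 0 < C ∧
      ∀ (N₁ N₂ : ℝ), 0 < N₁ → 0 < N₂ →
      ∀ (u₁ u₂ : RadialDisk.L2),
        RadialDisk.IsRadial u₁ → RadialDisk.IsRadial u₂ →
        RadialDisk.spectralProjection N₁ u₁ = u₁ →
        RadialDisk.spectralProjection N₂ u₂ = u₂ →
        (N₂ ≤ N₁ →
          RadialDisk.spaceTimeNorm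
              (fun t x => RadialDisk.flow α t u₁ x * RadialDisk.flow α t u₂ x) ≤
            ENNReal.ofReal (C * N₂ ^ (1 / 2 + ε) * ‖u₁‖ * ‖u₂‖)) ∧
        (∀ t : ℝ, ∃ G : RadialDisk.Plane → EuclideanSpace ℂ (Fin 2),
          RadialDisk.IsWeakGradient (RadialDisk.flow α t u₁) G) ∧
        (∀ G : ℝ → RadialDisk.Plane → EuclideanSpace ℂ (Fin 2),
          (∀ t : ℝ, RadialDisk.IsWeakGradient (RadialDisk.flow α t u₁) (G t)) →
          RadialDisk.spaceTimeNorm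
              (fun t x => RadialDisk.flow α t u₂ x • G t x) ≤
            ENNReal.ofReal (C * N₁ * N₂ ^ (1 / 2 + ε) * ‖u₁‖ * ‖u₂‖)) := by
  open RadialDisk in
  obtain ⟨M, hM, hbil⟩ := exists_bilinear_le hα.1 hε
  refine ⟨2 * M, by positivity, fun N₁ N₂ hN₁ hN₂ u₁ u₂ _ _ hu₁ hu₂ => ?_⟩
  obtain ⟨S, hS, hflow₁⟩ := exists_flow_eq_sum hN₁ hu₁
  obtain ⟨T, hT, hflow₂⟩ := exists_flow_eq_sum hN₂ hu₂
  have hae₁ := fun t => flow_ae_eq_expSum (hflow₁ α t)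
  have hae₂ := fun t => flow_ae_eq_expSum (hflow₂ α t)
  have hgrad : ∀ t, IsWeakGradient (flow α t u₁) (expSumGrad S (fun z => (z : ℝ) ^ (2 * α))
      (fun z => inner ℂ (eigenfun z) u₁) t) := fun t =>
    isWeakGradient_expSumGrad S _ _ t (hae₁ t)
  refine ⟨fun _ => ?_, fun t => ⟨_, hgrad t⟩, fun G hG => ?_⟩
  · have hb := hbil 1 N₂ one_pos hN₂ S T hT (fun z => profile z)
      (fun z => continuous_profile z) (fun z _ r _ => .inl (one_mul _).ge) u₁ u₂
    refine (spaceTimeNorm_le_of_lintegral_le (by positivity) (fun t => ?_) hb).trans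
      (ENNReal.ofReal_le_ofReal ?_)
    · filter_upwards [hae₁ t, hae₂ t] with x h₁ h₂
      rw [h₁, h₂, norm_mul]
    · have h2M : M * 1 ≤ 2 * M := by linarith
      gcongr
  · -- The factor `z ≤ 2 * N₁` produced by the gradient accounts for the loss of `N₁`.
    have hslope : ∀ z ∈ S, ∀ r : ℝ, 0 < r →
        |(z : ℝ) * gradProfile z r| ≤ 2 * N₁ * |gradProfile z r| := by
      intro z hz r _
      have hz0 : (0 : ℝ) < z := z.2.1
      rw [abs_mul, abs_of_pos hz0]
      gcongr
      exact (hS z hz).2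
    have hb := hbil (2 * N₁) N₂ (by positivity) hN₂ S T hT (fun z r => z * gradProfile z r)
      (fun z => continuous_const.mul (continuous_gradProfile z))
      (fun z hz r hr => .inr (hslope z hz r hr)) u₁ u₂
    refine (spaceTimeNorm_le_of_lintegral_le (by positivity) (fun t => ?_) hb).trans_eq ?_
    · filter_upwards [(hG t).ae_eq (hgrad t), hae₂ t] with x h₁ h₂
      rw [h₁, h₂, norm_smul, norm_expSumGrad, mul_comm]
    · congr 1
      ring
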